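/- Let $d\ge 1$, let $\mathcal T\in\mathbb R^{n_1\times\cdots\times n_d}$ be a nonzero tensor of multilinear rank $\mathbf r=(r_1,\dots,r_d)$, i.e. $\operatorname{rank}\mathscr M_i(\mathcal T)=r_i$ for all $i$, where $\mathscr M_i$ is the mode-$i$ matricization, and put $\kappa_1=\sigma_1(\mathscr M_1(\mathcal T))/\sigma_{r_1}(\mathscr M_1(\mathcal T))$. Let $\mathscr A:\mathbb R^{n_1\times\cdots\times n_d}\to\mathbb R^m$ be linear and satisfy the first-mode restricted isometry property of rank $3r_1$ with constant $R=R_{3r_1}$, i.e. $(1-R)\|\mathcal Z\|_F^2\le\|\mathscr A(\mathcal Z)\|_2^2\le(1+R)\|\mathcal Z\|_F^2$ for all $\mathcal Z$ with $\operatorname{rank}\mathscr M_1(\mathcal Z)\le 3r_1$. Define $$\gamma_2=\frac{2R}{1-R}\Big(4\sqrt{r_1}\,\kappa_1\big(2(\sqrt{d-1}+1)+R\big)+\sqrt d+2\Big)$$ and assume $$R<\min\Big(\frac12,\ \frac1{(32\sqrt{d-1}+40)\sqrt{r_1}\,\kappa_1+4\sqrt d+8}\Big).$$ The SM-QRGD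 algorithm with normalized step size produces tensors $\mathcal W^k,\mathcal X^k,\hat{\mathcal X}^k$ as follows. Start from $\mathcal W^0=\mathscr A^*\mathscr A(\mathcal T)$. Given $\mathcal W^k$, compute its sequentially truncated HOSVD (ST-HOSVD): for $i=1,\dots,d$ successively, let $U_i^k\in\mathbb R^{n_i\times r_i}$ be the matrix of left singular vectors of a truncated-$r_i$ SVD of $\mathscr M_i\big(\mathcal W^k\times_1(U_1^k)^T\times_2\cdots\times_{i-1}(U_{i-1}^k)^T\big)$; put $\mathcal C^k=\mathcal W^k\times_1(U_1^k)^T\times_2\cdots\times_d(U_d^k)^T$ and $\mathcal X^k=\mathcal C^k\times_1U_1^k\times_2\cdots\times_dU_d^k$. Let $U_1^k\Sigma^k(V_1^k)^T$ be the truncated-$r_1$ SVD of $\mathscr M_1(\mathcal W^k)$ used in the first of these steps, let $\hat{\mathcal X}^k=\mathscr M_1^{-1}(U_1^k\Sigma^k(V_1^k)^T)$, and let $\mathscr P_{\hat{\mathbb T}^k}=\mathscr M_1^{-1}\circ\mathscr P_{\hat T^k}\circ\mathscr M_1$ with $$\mathscr P_{\hat T^k}(Y)=U_1^k(U_1^k)^TY+YV_1^k(V_1^k)^T-U_1^k(U_1^k)^TYV_1^k(V_1^k)^T.$$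 With $\mathcal G^k=\mathscr A^*\mathscr A(\mathcal T-\mathcal X^k)$ and the step size $$\alpha_k=\frac{\|\mathscr P_{\hat{\mathbb T}^k}(\mathcal G^k)\|_F^2}{\|\mathscr A(\mathscr P_{\hat{\mathbb T}^k}(\mathcal G^k))\|_2^2}$$ (with $\alpha_k=0$ if $\mathscr P_{\hat{\mathbb T}^k}(\mathcal G^k)=0$), set $\mathcal W^{k+1}=\mathscr P_{\hat{\mathbb T}^k}(\mathcal X^k+\alpha_k\mathcal G^k)$. Then $0\le\gamma_2<1$ and, whatever choices of singular vectors are made, for all $k\ge 0$, $$\|\mathcal X^{k+1}-\mathcal T\|_F\le(\sqrt d+1)(8\sqrt{d-1}+10)\,\gamma_2^{\,k}\,\|\mathcal T\|_F .$$ -/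

import Mathlib

noncomputable section

namespace TensorRecovery

variable {d : ℕ}

/-- Real tensors of order `d` and size `n 0 × ⋯ × n (d - 1)`. The norm and inner product of
`EuclideanSpace` are the Frobenius norm and the entrywise inner product. -/
abbrev Tensor (n : Fin d → ℕ) : Type := EuclideanSpace ℝ ((i : Fin d) → Fin (n i))

/-- Column indices of the mode-`k` matricization: multi-indices over the modes other than `k`. -/
abbrev ColIdx (n : Fin d → ℕ) (k : Fin d) : Type := (j : {j : Fin d // j ≠ k}) → Fin (n j)

/-- The mode-`k` matricization of a tensor: rows are indexed by the `k`-th index, columns by the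
remaining indices. -/
def unfold {n : Fin d → ℕ} (k : Fin d) (X : Tensor n) : Matrix (Fin (n k)) (ColIdx n k) ℝ :=
  Matrix.of fun a b => X ((Equiv.piSplitAt k fun j => Fin (n j)).symm (a, b))

/-- The inverse of the mode-`k` matricization. -/
def refold {n : Fin d → ℕ} (k : Fin d) (Y : Matrix (Fin (n k)) (ColIdx n k) ℝ) : Tensor n :=
  WithLp.toLp 2 fun c => Y (c k) (fun j => c j)

theorem refold_unfold {n : Fin d → ℕ} (k : Fin d) (X : Tensor n) : refold k (unfold k X) = X := by
  ext c
  exact congrArg X ((Equiv.piSplitAt k fun j => Fin (n j)).symm_apply_apply c)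

theorem unfold_refold {n : Fin d → ℕ} (k : Fin d) (Y : Matrix (Fin (n k)) (ColIdx n k) ℝ) :
    unfold k (refold k Y) = Y := by
  ext a b
  have h := (Equiv.piSplitAt k fun j => Fin (n j)).apply_symm_apply (a, b)
  exact congrArg (fun p : Fin (n k) × ColIdx n k => Y p.1 p.2) h

/-- The multilinear product `X ×₁ M₁ ×₂ ⋯ ×_d M_d` of a tensor with one matrix in every mode. -/
def tuckerMul {n p : Fin d → ℕ} (M : (i : Fin d) → Matrix (Fin (p i)) (Fin (n i)) ℝ)
    (X : Tensor n) : Tensor p :=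
  WithLp.toLp 2 fun a => ∑ b : ((i : Fin d) → Fin (n i)), (∏ i, M i (a i) (b i)) * X b

/-- `Y = U diag(s) Vᵀ` is a singular value decomposition with `N` terms (thin form): orthonormal
columns, nonnegative singular values in decreasing order. -/
structure IsSVD {m c : Type} [Fintype m] [Fintype c] {N : ℕ} (Y : Matrix m c ℝ)
    (U : Matrix m (Fin N) ℝ) (s : Fin N → ℝ) (V : Matrix c (Fin N) ℝ) : Prop where
  left_orthonormal : U.transpose * U = 1
  right_orthonormal : V.transpose * V = 1
  nonneg : ∀ i, 0 ≤ s i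
  antitone : Antitone s
  eq : Y = U * Matrix.diagonal s * V.transpose

/-- `U, s, V` is a truncated-`q` singular value decomposition of `Y`: the first `q` singular
triples of some singular value decomposition of `Y`. -/
def IsTruncatedSVD {m c : Type} [Fintype m] [Fintype c] {q : ℕ} (Y : Matrix m c ℝ)
    (U : Matrix m (Fin q) ℝ) (s : Fin q → ℝ) (V : Matrix c (Fin q) ℝ) : Prop :=
  ∃ (N : ℕ) (hN : q ≤ N) (U' : Matrix m (Fin N) ℝ) (s' : Fin N → ℝ) (V' : Matrix c (Fin N) ℝ),
    IsSVD Y U' s' V' ∧ U = U'.submatrix id (Fin.castLE hN) ∧ s = s' ∘ Fin.castLE hN ∧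
      V = V'.submatrix id (Fin.castLE hN)

/-- The size of the intermediate tensor in the sequentially truncated HOSVD just before mode `i`
is processed: the modes before `i` have already been reduced from `n j` to `r j`. -/
def stDim (n r : Fin d → ℕ) (i j : Fin d) : ℕ := if j < i then r j else n j

theorem stDim_of_lt {n r : Fin d → ℕ} {i j : Fin d} (h : j < i) : stDim n r i j = r j := if_pos h

theorem stDim_of_not_lt {n r : Fin d → ℕ} {i j : Fin d} (h : ¬ j < i) : stDim n r i j = n j :=
  if_neg h

theorem stDim_self (n r : Fin d → ℕ) (i : Fin d) : stDim n r i i = n i :=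
  stDim_of_not_lt (lt_irrefl i)

/-- The matrix applied in mode `j` before mode `i` is processed: `U_jᵀ` for the modes `j < i`,
the identity for the others. -/
def stFactor {n r : Fin d → ℕ} (U : (i : Fin d) → Matrix (Fin (n i)) (Fin (r i)) ℝ)
    (i j : Fin d) : Matrix (Fin (stDim n r i j)) (Fin (n j)) ℝ :=
  if h : j < i then (U j).transpose.submatrix (Fin.cast (stDim_of_lt h)) id
  else (1 : Matrix (Fin (n j)) (Fin (n j)) ℝ).submatrix (Fin.cast (stDim_of_not_lt h)) id

/-- The intermediate tensor `ℬ = Z ×₁ U₁ᵀ ×₂ ⋯ ×_{i-1} U_{i-1}ᵀ` of the sequentially truncated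
HOSVD just before mode `i` is processed. -/
def stTensor {n r : Fin d → ℕ} (U : (i : Fin d) → Matrix (Fin (n i)) (Fin (r i)) ℝ)
    (i : Fin d) (Z : Tensor n) : Tensor (stDim n r i) :=
  tuckerMul (stFactor U i) Z

/-- The matrices `U` are factor matrices computed by the sequentially truncated HOSVD of `Z` with
truncation `r`: `U_i` comes from a truncated-`r_i` SVD of the mode-`i` matricization of the
intermediate tensor `ℬ`, which has been compressed in all the previous modes. (Singular vectors
are not unique; every possible choice is allowed.) -/
def IsSTHOSVD {n r : Fin d → ℕ} (Z : Tensor n)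
    (U : (i : Fin d) → Matrix (Fin (n i)) (Fin (r i)) ℝ) : Prop :=
  ∀ i, ∃ (s : Fin (r i) → ℝ) (V : Matrix (ColIdx (stDim n r i) i) (Fin (r i)) ℝ),
    IsTruncatedSVD ((unfold i (stTensor U i Z)).submatrix (Fin.cast (stDim_self n r i).symm) id)
      (U i) s V

/-- The output of the sequentially truncated HOSVD with factor matrices `U`:
`𝒞 ×₁ U₁ ×₂ ⋯ ×_d U_d` with core tensor `𝒞 = Z ×₁ U₁ᵀ ×₂ ⋯ ×_d U_dᵀ`. -/
def tuckerApprox {n r : Fin d → ℕ} (U : (i : Fin d) → Matrix (Fin (n i)) (Fin (r i)) ℝ)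
    (Z : Tensor n) : Tensor n :=
  tuckerMul U (tuckerMul (fun i => (U i).transpose) Z)

/-- The projection `Y ↦ U Uᵀ Y + Y V Vᵀ - U Uᵀ Y V Vᵀ` onto the matrix tangent space
`{U Rᵀ + L Vᵀ}`. -/
def tangentProj {m c : Type} [Fintype m] [Fintype c] {q : ℕ} (U : Matrix m (Fin q) ℝ)
    (V : Matrix c (Fin q) ℝ) (Y : Matrix m c ℝ) : Matrix m c ℝ :=
  U * U.transpose * Y + Y * (V * V.transpose) - U * U.transpose * Y * (V * V.transpose)

/-- The single-mode (first-mode) tangent space projection of a tensor. -/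
def modeTangentProj [NeZero d] {n : Fin d → ℕ} {q : ℕ} (U : Matrix (Fin (n 0)) (Fin q) ℝ)
    (V : Matrix (ColIdx n 0) (Fin q) ℝ) (Z : Tensor n) : Tensor n :=
  refold 0 (tangentProj U V (unfold 0 Z))

/-- The first-mode restricted isometry property of rank `q` with constant `R`. -/
def FirstModeRIP [NeZero d] {n : Fin d → ℕ} {m : ℕ}
    (A : Tensor n →ₗ[ℝ] EuclideanSpace ℝ (Fin m)) (q : ℕ) (R : ℝ) : Prop :=
  ∀ Z : Tensor n, (unfold 0 Z).rank ≤ q →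
    (1 - R) * ‖Z‖ ^ 2 ≤ ‖A Z‖ ^ 2 ∧ ‖A Z‖ ^ 2 ≤ (1 + R) * ‖Z‖ ^ 2

/-- The condition number `σ₁ / σ_q` of a matrix of rank `q`
(`LinearMap.singularValues` counts from zero). -/
def condNumber {m c : Type} [Fintype m] [Fintype c] [DecidableEq c] (Y : Matrix m c ℝ)
    (q : ℕ) : ℝ :=
  (Matrix.toEuclideanLin Y).singularValues 0 / (Matrix.toEuclideanLin Y).singularValues (q - 1)

/-- The normal operator `𝒜* 𝒜`. -/
def normalOp {n : Fin d → ℕ} {m : ℕ} (A : Tensor n →ₗ[ℝ] EuclideanSpace ℝ (Fin m)) :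
    Tensor n →ₗ[ℝ] Tensor n :=
  LinearMap.adjoint A ∘ₗ A

/-- `X, Xhat, W` (with the singular triples `U, s, V`) is a run of the single-mode quasi-Riemannian
gradient descent for the measurements of `T` under `A`, with target rank `r` and step sizes `α`.
Here `W 0 = 𝒜* 𝒜 T` is the tensor from which the initial points are computed. In every iteration
one truncated-`r₁` SVD of the first matricization of `W k` serves as the first pass of the
sequentially truncated HOSVD, for `Xhat k`, and for the next tangent space. -/
structure IsSMQRGD [NeZero d] {n : Fin d → ℕ} {m : ℕ}
    (A : Tensor n →ₗ[ℝ] EuclideanSpace ℝ (Fin m)) (T : Tensor n) (r : Fin d → ℕ) (α : ℕ → ℝ)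
    (X Xhat W : ℕ → Tensor n)
    (U : ℕ → (i : Fin d) → Matrix (Fin (n i)) (Fin (r i)) ℝ)
    (s : ℕ → Fin (r 0) → ℝ) (V : ℕ → Matrix (ColIdx n 0) (Fin (r 0)) ℝ) : Prop where
  init : W 0 = normalOp A T
  svd : ∀ k, IsTruncatedSVD (unfold 0 (W k)) (U k 0) (s k) (V k)
  xhat : ∀ k, Xhat k = refold 0 (U k 0 * Matrix.diagonal (s k) * (V k).transpose)
  sthosvd : ∀ k, IsSTHOSVD (W k) (U k)
  x : ∀ k, X k = tuckerApprox (U k) (W k)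
  step : ∀ k, W (k + 1) = modeTangentProj (U k 0) (V k) (X k + α k • normalOp A (T - X k))

end TensorRecovery

end

/-! Four errors are followed along the run: `e k = ‖W k - T‖`, `h k = ‖Xhat k - T‖`, `x k = ‖X k -
T‖` and the normal component `ν k = ‖T - P T‖`, where `P` is the tangent projection at `Xhat k`.

Truncation loses only constants. `Xhat k` is a best approximation of `W k` of first-mode rank at
most `r 0`, so `h ≤ 2 e`. The ST-HOSVD error splits into orthogonal increments, one per mode, each
controlled by Eckart–Young. Counting from `W k` there are `d` increments, and from `Xhat k`, which
is the stage after the first mode, there are `d - 1`. Hence `x ≤ (√d + 1) e` and `x ≤ (√(d-1) + 1)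
h` (`IsSTHOSVD.norm_sub_tuckerApprox_le`).

The gradient step contracts. `X k` is fixed by `P`, and the range of `P` together with `T - P T`
consists of tensors of first-mode rank at most `3 r 0`, where `A` is nearly isometric. Thus `e (k+1)
≤ 2R/(1-R) x k + (R/(1-R) + 1) ν k` (`norm_projected_step_le`).

The term `1 · ν k` carries no small factor. It is tamed by the curvature of the low-rank set: `σ ν ≤
h²` with `σ` the least nonzero singular value of the first unfolding of `T`
(`frobenius_sub_tangentProj_le_sq`), so `ν` is a small multiple of `e` once `e` is small against
`σ`. The comparison `‖T‖ ≤ √r₁ κ₁ σ` and the initial bound `h 0 ≤ 2R‖T‖`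
(`norm_sub_le_of_norm_sub_normal_le`) secure this from the first step on, and `error_recursion`
combines the estimates into the rate `γ₂`. -/

noncomputable section

namespace TensorRecovery

variable {d : ℕ}

/-! ### Frobenius norm, orthogonal projections and the thin SVD -/

section MatrixLemmas

open Matrix

attribute [local instance] Matrix.frobeniusNormedAddCommGroup

variable {m c q p : Type*} [Fintype m] [Fintype c] [Fintype q] [Fintype p]

theorem frobenius_sq_eq_sum (A : Matrix m c ℝ) : ‖A‖ ^ 2 = ∑ i, ∑ j, A i j ^ 2 := by
  rw [Matrix.frobenius_norm_def, ← Real.sqrt_eq_rpow, Real.sq_sqrt (by positivity)]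
  simp

theorem frobenius_sq_eq_trace (A : Matrix m c ℝ) : ‖A‖ ^ 2 = (Aᵀ * A).trace := by
  rw [frobenius_sq_eq_sum, Finset.sum_comm]
  simp [Matrix.trace, Matrix.mul_apply, sq]

theorem frobenius_sq_eq_of_gram_eq {A : Matrix m c ℝ} {B : Matrix p c ℝ} (h : Aᵀ * A = Bᵀ * B) :
    ‖A‖ = ‖B‖ := by
  rw [← sq_eq_sq₀ (norm_nonneg _) (norm_nonneg _), frobenius_sq_eq_trace, frobenius_sq_eq_trace, h]

theorem frobenius_orthonormal_mul [DecidableEq q] {U : Matrix m q ℝ} (hU : Uᵀ * U = 1)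
    (A : Matrix q c ℝ) : ‖U * A‖ = ‖A‖ :=
  frobenius_sq_eq_of_gram_eq (by
    rw [transpose_mul, Matrix.mul_assoc, ← Matrix.mul_assoc Uᵀ, hU, Matrix.one_mul])

theorem frobenius_mul_orthonormal_transpose [DecidableEq q] {V : Matrix c q ℝ} (hV : Vᵀ * V = 1)
    (A : Matrix m q ℝ) : ‖A * Vᵀ‖ = ‖A‖ := by
  rw [← frobenius_norm_transpose, transpose_mul, transpose_transpose,
    frobenius_orthonormal_mul hV, frobenius_norm_transpose]

theorem frobenius_sq_sub_projection [DecidableEq q] {U : Matrix m q ℝ} (hU : Uᵀ * U = 1)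
    (A : Matrix m c ℝ) : ‖A - U * Uᵀ * A‖ ^ 2 = ‖A‖ ^ 2 - ‖Uᵀ * A‖ ^ 2 := by
  simp only [frobenius_sq_eq_trace]
  rw [← trace_sub]
  congr 1
  have h : Uᵀ * (U * (Uᵀ * A)) = Uᵀ * A := by rw [← Matrix.mul_assoc Uᵀ, hU, Matrix.one_mul]
  simp only [transpose_sub, transpose_mul, transpose_transpose, Matrix.sub_mul, Matrix.mul_sub,
    Matrix.mul_assoc, h]
  abel

theorem frobenius_transpose_mul_le [DecidableEq q] {U : Matrix m q ℝ} (hU : Uᵀ * U = 1)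
    (A : Matrix m c ℝ) : ‖Uᵀ * A‖ ≤ ‖A‖ := by
  have := frobenius_sq_sub_projection hU A
  refine le_of_sq_le_sq ?_ (norm_nonneg _)
  nlinarith [sq_nonneg ‖A - U * Uᵀ * A‖]

theorem frobenius_sub_projection_le [DecidableEq q] {U : Matrix m q ℝ} (hU : Uᵀ * U = 1)
    (A : Matrix m c ℝ) : ‖A - U * Uᵀ * A‖ ≤ ‖A‖ := by
  have := frobenius_sq_sub_projection hU A
  refine le_of_sq_le_sq ?_ (norm_nonneg _)
  nlinarith [sq_nonneg ‖Uᵀ * A‖]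

theorem frobenius_sub_mul_projection_le [DecidableEq q] {V : Matrix c q ℝ} (hV : Vᵀ * V = 1)
    (A : Matrix m c ℝ) : ‖A - A * (V * Vᵀ)‖ ≤ ‖A‖ := by
  have := frobenius_sub_projection_le hV Aᵀ
  rw [← frobenius_norm_transpose, ← frobenius_norm_transpose A]
  simpa [transpose_sub, transpose_mul, Matrix.mul_assoc] using this

theorem frobenius_mul_orthonormal_le [DecidableEq q] {V : Matrix c q ℝ} (hV : Vᵀ * V = 1)
    (A : Matrix m c ℝ) : ‖A * V‖ ≤ ‖A‖ := by
  have := frobenius_transpose_mul_le hV Aᵀ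
  rw [← frobenius_norm_transpose, ← frobenius_norm_transpose A]
  simpa [transpose_mul] using this

theorem rank_toEuclideanLin_range {m c : Type} [Fintype m] [Fintype c] [DecidableEq c]
    (Y : Matrix m c ℝ) :
    Module.finrank ℝ (Matrix.toEuclideanLin Y).range = Y.rank := by
  classical
  rw [Matrix.rank_eq_finrank_range_toLin Y (PiLp.basisFun 2 ℝ m) (PiLp.basisFun 2 ℝ c)]
  rfl

/-- The thin singular value decomposition, with `Matrix.rank` many terms. -/
theorem exists_thin_svd {m c : Type} [Fintype m] [Fintype c] [DecidableEq c] (Y : Matrix m c ℝ) :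
    ∃ (U : Matrix m (Fin Y.rank) ℝ) (V : Matrix c (Fin Y.rank) ℝ), Uᵀ * U = 1 ∧ Vᵀ * V = 1 ∧
      Y = U * Matrix.diagonal
        (fun i : Fin Y.rank => (Matrix.toEuclideanLin Y).singularValues i) * Vᵀ := by
  classical
  set L := Matrix.toEuclideanLin Y with hL
  have hrank : Module.finrank ℝ L.range = Y.rank := rank_toEuclideanLin_range Y
  set σ : ℕ → ℝ := fun i => L.singularValues i with hσ
  have hN : Module.finrank ℝ (EuclideanSpace ℝ c) = Fintype.card c := finrank_euclideanSpace
  set b := L.isSymmetric_adjoint_comp_self.eigenvectorBasis hN with hb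
  have hgram : ∀ i j, inner ℝ (L (b i)) (L (b j)) = if i = j then σ i ^ 2 else 0 := by
    intro i j
    rw [← LinearMap.adjoint_inner_right L, ← LinearMap.comp_apply,
      hb, LinearMap.IsSymmetric.apply_eigenvectorBasis, inner_smul_right,
      orthonormal_iff_ite.mp (OrthonormalBasis.orthonormal _) i j]
    split_ifs with h
    · subst h
      simp [hσ, L.sq_singularValues_fin hN i]
    · simp
  have hle : Y.rank ≤ Fintype.card c := Matrix.rank_le_card_width Y
  have hpos : ∀ i : Fin Y.rank, 0 < σ i := fun i =>
    L.singularValues_pos_iff_lt_finrank_range.mpr (by rw [hrank]; exact i.2)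
  have hzero : ∀ i : Fin (Fintype.card c), Y.rank ≤ i → L (b i) = 0 := by
    intro i hi
    rw [← inner_self_eq_zero (𝕜 := ℝ), hgram, if_pos rfl,
      show σ i = 0 from L.singularValues_eq_zero_iff_le_finrank_range.mpr (by rw [hrank]; exact hi)]
    simp
  -- The right vectors are the leading eigenvectors `b i` of `L* L`, the left vectors are `L (b i) /
  -- σ i`. Their orthonormality is `hgram`, and by `hzero` the remaining eigenvectors contribute
  -- nothing.
  refine ⟨Matrix.of fun a i => (σ i)⁻¹ * L (b (Fin.castLE hle i)) a,
    Matrix.of fun a i => b (Fin.castLE hle i) a, ?_, ?_, ?_⟩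
  · ext i j
    have h := hgram (Fin.castLE hle j) (Fin.castLE hle i)
    rw [PiLp.inner_apply] at h
    have : ∀ x, (σ i)⁻¹ * L (b (Fin.castLE hle i)) x * ((σ j)⁻¹ * L (b (Fin.castLE hle j)) x) =
      (σ i)⁻¹ * (σ j)⁻¹ * inner ℝ (L (b (Fin.castLE hle j)) x) (L (b (Fin.castLE hle i)) x) := by
      intro x
      simp
      ring
    simp only [Matrix.mul_apply, Matrix.transpose_apply, Matrix.of_apply, this]
    rw [← Finset.mul_sum, h, Matrix.one_apply]
    have h2 := (hpos i).ne'
    by_cases hij : i = j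
    · subst hij
      simp
      field_simp
    · rw [if_neg hij, if_neg, mul_zero]
      intro h3
      exact hij (Fin.castLE_injective hle h3).symm
  · ext i j
    have h := orthonormal_iff_ite.mp b.orthonormal (Fin.castLE hle j) (Fin.castLE hle i)
    rw [PiLp.inner_apply] at h
    simp only [Matrix.mul_apply, Matrix.transpose_apply, Matrix.of_apply, Matrix.one_apply]
    simp only [RCLike.inner_apply, conj_trivial] at h
    rw [h]
    simp [(Fin.castLE_injective hle).eq_iff, eq_comm]
  · ext x y
    have h1 : L (EuclideanSpace.single y 1) =
        ∑ i, b i y • L (b i) := by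
      conv_lhs => rw [← b.sum_repr' (EuclideanSpace.single y 1)]
      simp [map_sum, EuclideanSpace.inner_single_right]
    have h2 : Y x y = L (EuclideanSpace.single y 1) x := by
      simp [hL, Matrix.toLpLin_apply]
    rw [h2, h1]
    rw [Matrix.mul_apply]
    simp only [Matrix.mul_diagonal, Matrix.transpose_apply, Matrix.of_apply]
    have h3 : ∑ i, b i y • L (b i) = ∑ i : Fin Y.rank,
        b (Fin.castLE hle i) y • L (b (Fin.castLE hle i)) := by
      refine Eq.trans ?_ (Finset.sum_map Finset.univ (Fin.castLEEmb hle) fun i => b i y • L (b i))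
      symm
      apply Finset.sum_subset (Finset.subset_univ _)
      intro i _ hi
      rw [hzero i, smul_zero]
      by_contra! hlt
      exact hi (by
        simp only [Finset.mem_map, Finset.mem_univ, true_and]
        exact ⟨⟨i, hlt⟩, rfl⟩)
    rw [h3]
    simp only [WithLp.ofLp_sum, Finset.sum_apply, PiLp.smul_apply, smul_eq_mul]
    refine Finset.sum_congr rfl fun i _ => ?_
    have := (hpos i).ne'
    change _ = (σ i)⁻¹ * _ * σ i * _
    field_simp

/-- Exchange argument: moving weight from indices `≥ q` to indices `< q` can only increase the sum.
This is the optimization behind Eckart–Young. -/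
theorem sum_mul_le_sum_castLE {N q : ℕ} (hN : q ≤ N) {a w : Fin N → ℝ} (ha : Antitone a)
    (ha0 : ∀ i, 0 ≤ a i) (hw0 : ∀ i, 0 ≤ w i) (hw1 : ∀ i, w i ≤ 1) (hw : ∑ i, w i ≤ q) :
    ∑ i, a i * w i ≤ ∑ i : Fin q, a (Fin.castLE hN i) := by
  -- The threshold separates kept from discarded values: it is `a q`, or `0` when `q = N` and
  -- nothing is discarded.
  obtain ⟨t, ht0, ht1, ht2⟩ : ∃ t : ℝ, 0 ≤ t ∧ (∀ i : Fin N, i.val < q → t ≤ a i) ∧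
      ∀ i : Fin N, q ≤ i.val → a i ≤ t := by
    by_cases h : q < N
    · exact ⟨a ⟨q, h⟩, ha0 _, fun i hi => ha (by simpa [Fin.le_def] using hi.le),
        fun i hi => ha (by simpa [Fin.le_def] using hi)⟩
    · refine ⟨0, le_rfl, fun i _ => ha0 i, fun i hi => absurd i.2 (by omega)⟩
  have h1 : ∑ i : Fin q, a (Fin.castLE hN i) = ∑ i : Fin N, if i.val < q then a i else 0 := by
    rw [← Finset.sum_filter]
    refine (Finset.sum_map Finset.univ (Fin.castLEEmb hN) a).symm.trans ?_
    congr 1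
    ext i
    simp only [Finset.mem_map, Finset.mem_univ, true_and, Finset.mem_filter]
    exact ⟨by rintro ⟨j, rfl⟩; exact j.2, fun h => ⟨⟨i, h⟩, rfl⟩⟩
  have h2 : (q : ℝ) = ∑ i : Fin N, if i.val < q then (1 : ℝ) else 0 := by
    rw [← Finset.sum_filter]
    have : (Finset.univ.filter fun i : Fin N => i.val < q) =
        Finset.univ.map (Fin.castLEEmb hN) := by
      ext i
      simp only [Finset.mem_map, Finset.mem_univ, true_and, Finset.mem_filter]
      exact ⟨fun h => ⟨⟨i, h⟩, rfl⟩, by rintro ⟨j, rfl⟩; exact j.2⟩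
    rw [this]
    simp
  have h3 : ∑ i, a i * w i - ∑ i : Fin N, (if i.val < q then a i else 0) ≤
      t * (∑ i, w i - ∑ i : Fin N, if i.val < q then (1 : ℝ) else 0) := by
    rw [← Finset.sum_sub_distrib, ← Finset.sum_sub_distrib, Finset.mul_sum]
    refine Finset.sum_le_sum fun i _ => ?_
    split_ifs with h
    · nlinarith [ht1 i h, hw1 i]
    · nlinarith [ht2 i (not_lt.mp h), hw0 i]
  rw [h1]
  rw [← h2] at h3
  nlinarith

theorem frobenius_sq_mul_diagonal {N : Type*} [Fintype N] [DecidableEq N] (A : Matrix m N ℝ)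
    (s : N → ℝ) : ‖A * Matrix.diagonal s‖ ^ 2 = ∑ i, s i ^ 2 * ∑ j, A j i ^ 2 := by
  rw [frobenius_sq_eq_sum, Finset.sum_comm]
  refine Finset.sum_congr rfl fun i _ => ?_
  rw [Finset.mul_sum]
  refine Finset.sum_congr rfl fun j _ => ?_
  rw [Matrix.mul_diagonal]
  ring

theorem frobenius_sq_of_orthonormal {q : ℕ} {U : Matrix m (Fin q) ℝ} (hU : Uᵀ * U = 1) :
    ‖U‖ ^ 2 = q := by
  rw [frobenius_sq_eq_trace, hU]
  simp

/-! ### Truncated SVDs and best low-rank approximation -/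

section TruncatedSVD

variable {m c : Type} [Fintype m] [Fintype c] {q : ℕ} {Y : Matrix m c ℝ} {U : Matrix m (Fin q) ℝ}
  {s : Fin q → ℝ} {V : Matrix c (Fin q) ℝ}

theorem submatrix_castLE_orthonormal {N : ℕ} (hN : q ≤ N) {U : Matrix m (Fin N) ℝ}
    (hU : Uᵀ * U = 1) :
    (U.submatrix id (Fin.castLE hN))ᵀ * U.submatrix id (Fin.castLE hN) = 1 := by
  have : (U.submatrix id (Fin.castLE hN))ᵀ * U.submatrix id (Fin.castLE hN) =
      (Uᵀ * U).submatrix (Fin.castLE hN) (Fin.castLE hN) := rfl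
  rw [this, hU, Matrix.submatrix_one _ (Fin.castLE_injective hN)]

theorem IsTruncatedSVD.left_orthonormal (h : IsTruncatedSVD Y U s V) : Uᵀ * U = 1 := by
  obtain ⟨N, hN, U', s', V', h, rfl, rfl, rfl⟩ := h
  exact submatrix_castLE_orthonormal hN h.left_orthonormal

theorem IsTruncatedSVD.right_orthonormal (h : IsTruncatedSVD Y U s V) : Vᵀ * V = 1 := by
  obtain ⟨N, hN, U', s', V', h, rfl, rfl, rfl⟩ := h
  exact submatrix_castLE_orthonormal hN h.right_orthonormal

theorem IsTruncatedSVD.transpose_left_mul (h : IsTruncatedSVD Y U s V) :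
    Uᵀ * Y = Matrix.diagonal s * Vᵀ := by
  obtain ⟨N, hN, U', s', V', h, rfl, rfl, rfl⟩ := h
  have h1 : U'ᵀ * Y = Matrix.diagonal s' * V'ᵀ := by
    rw [h.eq, Matrix.mul_assoc, ← Matrix.mul_assoc U'ᵀ, h.left_orthonormal, Matrix.one_mul]
  have h2 : (U'.submatrix id (Fin.castLE hN))ᵀ * Y =
    (U'ᵀ * Y).submatrix (Fin.castLE hN) id := rfl
  rw [h2, h1]
  ext i j
  simp [Matrix.diagonal_mul]

theorem IsTruncatedSVD.projection_mul (h : IsTruncatedSVD Y U s V) :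
    U * Uᵀ * Y = U * Matrix.diagonal s * Vᵀ := by
  rw [Matrix.mul_assoc, h.transpose_left_mul, Matrix.mul_assoc]

/-- The Eckart–Young theorem in the Frobenius norm. -/
theorem IsTruncatedSVD.frobenius_sub_projection_le (h : IsTruncatedSVD Y U s V)
    {B : Matrix m c ℝ} (hB : B.rank ≤ q) : ‖Y - U * Uᵀ * Y‖ ≤ ‖Y - B‖ := by
  classical
  have hU := h.left_orthonormal
  have hV := h.right_orthonormal
  have hUY := h.transpose_left_mul
  obtain ⟨N, hN, U', s', V', h, rfl, rfl, rfl⟩ := h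
  obtain ⟨Q, Z, hQ, -, hBQ⟩ := exists_thin_svd B
  have hQB : Q * Qᵀ * B = B := by
    have h0 : ∀ D : Matrix (Fin B.rank) (Fin B.rank) ℝ, Q * Qᵀ * (Q * D * Zᵀ) = Q * D * Zᵀ := by
      intro D
      rw [Matrix.mul_assoc Q _ Zᵀ, Matrix.mul_assoc Q Qᵀ, ← Matrix.mul_assoc Qᵀ, hQ,
        Matrix.one_mul]
    have h1 := h0 (Matrix.diagonal fun i => (Matrix.toEuclideanLin B).singularValues i)
    rwa [← hBQ] at h1
  -- With `Q` an orthonormal basis of the column space of `B`, projecting `Y` onto it does at least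
  -- as well as `B`. It remains to compare the energies captured by the two projections.
  have h1 : ‖Y - Q * Qᵀ * Y‖ ≤ ‖Y - B‖ := by
    convert TensorRecovery.frobenius_sub_projection_le hQ (Y - B) using 2
    rw [Matrix.mul_sub, hQB]
    abel
  refine le_trans (le_of_sq_le_sq ?_ (norm_nonneg _)) h1
  rw [frobenius_sq_sub_projection hU, frobenius_sq_sub_projection hQ, hUY,
    frobenius_mul_orthonormal_transpose hV]
  have h2 : Qᵀ * Y = Qᵀ * U' * Matrix.diagonal s' * V'ᵀ := by
    rw [h.eq]
    simp only [Matrix.mul_assoc]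
  have h3 : ‖Matrix.diagonal (s' ∘ Fin.castLE hN)‖ ^ 2 = ∑ i, s' (Fin.castLE hN i) ^ 2 := by
    rw [← Matrix.one_mul (Matrix.diagonal (s' ∘ Fin.castLE hN)), frobenius_sq_mul_diagonal]
    simp [Matrix.one_apply]
  rw [h2, frobenius_mul_orthonormal_transpose h.right_orthonormal, frobenius_sq_mul_diagonal, h3]
  -- The weights are the squared norms of `Qᵀ` applied to the left singular vectors: each is at most
  -- `1`, and their sum is at most `‖Q‖² = B.rank ≤ q`.
  refine sub_le_sub_left (sum_mul_le_sum_castLE hN (a := fun i => s' i ^ 2) ?_ ?_ ?_ ?_ ?_) _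
  · exact fun i j hij => pow_le_pow_left₀ (h.nonneg j) (h.antitone hij) 2
  · exact fun i => sq_nonneg _
  · exact fun i => Finset.sum_nonneg fun j _ => sq_nonneg _
  · intro i
    have h4 := frobenius_transpose_mul_le hQ (U'.submatrix id (fun _ : Unit => i))
    have h5 : ‖U'.submatrix id (fun _ : Unit => i)‖ ^ 2 = 1 := by
      have h6 := congrFun (congrFun h.left_orthonormal i) i
      rw [Matrix.mul_apply, Matrix.one_apply_eq] at h6
      rw [frobenius_sq_eq_sum, ← h6]
      simp [sq]
    have h7 : ∑ j, (Qᵀ * U') j i ^ 2 = ‖Qᵀ * U'.submatrix id (fun _ : Unit => i)‖ ^ 2 := by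
      rw [frobenius_sq_eq_sum]
      simp [Matrix.mul_apply]
    rw [h7, ← h5]
    exact pow_le_pow_left₀ (norm_nonneg _) h4 2
  · rw [Finset.sum_comm, ← frobenius_sq_eq_sum, ← frobenius_norm_transpose, transpose_mul,
      transpose_transpose]
    calc ‖U'ᵀ * Q‖ ^ 2 ≤ ‖Q‖ ^ 2 :=
          pow_le_pow_left₀ (norm_nonneg _) (frobenius_transpose_mul_le h.left_orthonormal Q) 2
      _ = (B.rank : ℝ) := frobenius_sq_of_orthonormal hQ
      _ ≤ q := by exact_mod_cast hB

end TruncatedSVD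

/-! ### Distance from a matrix to a tangent space of the low-rank set -/

section TangentProjection

variable {m c : Type} [Fintype m] [Fintype c] {q : ℕ}

theorem frobenius_le_sqrt_rank_mul [DecidableEq c] (Y : Matrix m c ℝ) :
    ‖Y‖ ≤ √(Y.rank : ℝ) * (Matrix.toEuclideanLin Y).singularValues 0 := by
  obtain ⟨U, V, hU, hV, hY⟩ := exists_thin_svd Y
  set L := Matrix.toEuclideanLin Y
  have h0 := L.singularValues_nonneg 0
  refine le_of_sq_le_sq ?_ (by positivity)
  have h1 : ‖Y‖ ^ 2 = ∑ i : Fin Y.rank, L.singularValues i ^ 2 := by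
    conv_lhs => rw [hY]
    rw [frobenius_mul_orthonormal_transpose hV, frobenius_sq_mul_diagonal]
    refine Finset.sum_congr rfl fun i _ => ?_
    have h6 := congrFun (congrFun hU i) i
    rw [Matrix.mul_apply, Matrix.one_apply_eq] at h6
    simp only [Matrix.transpose_apply, ← sq] at h6
    rw [h6, mul_one]
  rw [h1, mul_pow, Real.sq_sqrt (by positivity)]
  calc _ ≤ ∑ i : Fin Y.rank, L.singularValues 0 ^ 2 := Finset.sum_le_sum fun i _ =>
        pow_le_pow_left₀ (L.singularValues_nonneg _) (L.singularValues_antitone (Nat.zero_le _)) 2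
    _ = _ := by simp

/-- A generalized inverse of `Y` with operator norm at most `1 / σ_r`. -/
theorem exists_generalized_inverse [DecidableEq c] (Y : Matrix m c ℝ) :
    ∃ B : Matrix c m ℝ, Y * B * Y = Y ∧ ∀ C : Matrix m c ℝ,
      (Matrix.toEuclideanLin Y).singularValues (Y.rank - 1) * ‖B * C‖ ≤ ‖C‖ := by
  obtain ⟨U, V, hU, hV, hY⟩ := exists_thin_svd Y
  set L := Matrix.toEuclideanLin Y with hL
  set σ : Fin Y.rank → ℝ := fun i => L.singularValues i with hσ
  have hpos : ∀ i, 0 < σ i := fun i =>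
    L.singularValues_pos_iff_lt_finrank_range.mpr (by rw [rank_toEuclideanLin_range]; exact i.2)
  refine ⟨V * Matrix.diagonal (fun i => (σ i)⁻¹) * Uᵀ, ?_, fun C => ?_⟩
  · have h1 : Matrix.diagonal σ * (Matrix.diagonal (fun i => (σ i)⁻¹) * Matrix.diagonal σ) =
        Matrix.diagonal σ := by
      rw [Matrix.diagonal_mul_diagonal, Matrix.diagonal_mul_diagonal]
      congr 1
      ext i
      have := (hpos i).ne'
      field_simp
    generalize Matrix.diagonal (fun i => (σ i)⁻¹) = E at *
    generalize Matrix.diagonal σ = D at *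
    have h2 : (U * D * Vᵀ) * (V * E * Uᵀ) * (U * D * Vᵀ) = U * D * Vᵀ := by
      calc _ = U * D * (Vᵀ * V) * E * (Uᵀ * U) * D * Vᵀ := by simp only [Matrix.mul_assoc]
        _ = U * (D * (E * D)) * Vᵀ := by
          rw [hU, hV]
          simp only [Matrix.mul_assoc, Matrix.one_mul]
        _ = _ := by rw [h1]
    rwa [← hY] at h2
  · rw [Matrix.mul_assoc, Matrix.mul_assoc, frobenius_orthonormal_mul hV]
    refine le_trans ?_ (frobenius_transpose_mul_le hU C)
    generalize Uᵀ * C = F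
    have h0 := L.singularValues_nonneg (Y.rank - 1)
    refine le_of_sq_le_sq ?_ (norm_nonneg _)
    rw [mul_pow, frobenius_sq_eq_sum, frobenius_sq_eq_sum, Finset.mul_sum]
    refine Finset.sum_le_sum fun i _ => ?_
    rw [Finset.mul_sum]
    refine Finset.sum_le_sum fun j _ => ?_
    rw [Matrix.diagonal_mul, mul_pow, ← mul_assoc, ← mul_pow]
    have h2 : L.singularValues (Y.rank - 1) ≤ σ i :=
      L.singularValues_antitone (by have := i.2; omega)
    have h3 : L.singularValues (Y.rank - 1) * (σ i)⁻¹ ≤ 1 := by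
      rw [← div_eq_mul_inv]
      exact div_le_one_of_le₀ h2 (hpos i).le
    have h4 : (L.singularValues (Y.rank - 1) * (σ i)⁻¹) ^ 2 ≤ 1 :=
      pow_le_one₀ (mul_nonneg h0 (inv_nonneg.mpr (hpos i).le)) h3
    nlinarith [sq_nonneg (F i j)]

variable {U : Matrix m (Fin q) ℝ} {V : Matrix c (Fin q) ℝ}

theorem sub_tangentProj (Y : Matrix m c ℝ) :
    Y - tangentProj U V Y = (Y - U * Uᵀ * Y) - (Y - U * Uᵀ * Y) * (V * Vᵀ) := by
  simp only [tangentProj, Matrix.sub_mul]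
  abel

/-- The complementary projection `Y ↦ (1 - U Uᵀ) Y (1 - V Vᵀ)` annihilates `U S Vᵀ` and does not
increase the norm, so `Y` may be replaced by `E`. -/
theorem frobenius_sub_tangentProj_le (hU : Uᵀ * U = 1) (hV : Vᵀ * V = 1)
    (Y E : Matrix m c ℝ) (S : Matrix (Fin q) (Fin q) ℝ) (hE : E = Y - U * S * Vᵀ) :
    ‖Y - tangentProj U V Y‖ ≤ ‖E‖ := by
  have h1 : Y - U * Uᵀ * Y = E - U * Uᵀ * E := by
    have h2 : U * Uᵀ * (U * S * Vᵀ) = U * S * Vᵀ := by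
      calc _ = U * (Uᵀ * U) * S * Vᵀ := by simp only [Matrix.mul_assoc]
        _ = _ := by rw [hU, Matrix.mul_one]
    rw [hE, Matrix.mul_sub, h2]
    abel
  rw [sub_tangentProj]
  refine (frobenius_sub_mul_projection_le hV _).trans ?_
  rw [h1]
  exact frobenius_sub_projection_le hU _

/-- The part of `Y` normal to the tangent space at `U S Vᵀ` is quadratically small in the distance
from `Y` to `U S Vᵀ`. -/
theorem frobenius_sub_tangentProj_le_sq [DecidableEq c] (hU : Uᵀ * U = 1) (hV : Vᵀ * V = 1)
    (Y E : Matrix m c ℝ) (S : Matrix (Fin q) (Fin q) ℝ) (hE : E = Y - U * S * Vᵀ) :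
    (Matrix.toEuclideanLin Y).singularValues (Y.rank - 1) * ‖Y - tangentProj U V Y‖ ≤
      ‖E‖ ^ 2 := by
  obtain ⟨B, hB, hBC⟩ := exists_generalized_inverse Y
  have h1 : Y - U * Uᵀ * Y = E - U * Uᵀ * E := by
    have h2 : U * Uᵀ * (U * S * Vᵀ) = U * S * Vᵀ := by
      calc _ = U * (Uᵀ * U) * S * Vᵀ := by simp only [Matrix.mul_assoc]
        _ = _ := by rw [hU, Matrix.mul_one]
    rw [hE, Matrix.mul_sub, h2]
    abel
  have h3 : Y - Y * (V * Vᵀ) = E - E * (V * Vᵀ) := by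
    have h2 : (U * S * Vᵀ) * (V * Vᵀ) = U * S * Vᵀ := by
      calc _ = U * S * (Vᵀ * V) * Vᵀ := by simp only [Matrix.mul_assoc]
        _ = _ := by rw [hV, Matrix.mul_one]
    rw [hE, Matrix.sub_mul, h2]
    abel
  -- Inserting `Y = Y B Y` splits the two-sided complement into a left and a right residual with `B`
  -- between them. Each residual depends on `E` alone, so the product is quadratic in `E`.
  have h4 : Y - tangentProj U V Y = (Y - U * Uᵀ * Y) * (B * (Y - Y * (V * Vᵀ))) := by
    rw [sub_tangentProj]
    have h5 : (Y - U * Uᵀ * Y) * (B * (Y - Y * (V * Vᵀ))) =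
        Y * B * Y - U * Uᵀ * (Y * B * Y) -
          (Y * B * Y - U * Uᵀ * (Y * B * Y)) * (V * Vᵀ) := by
      simp only [Matrix.mul_sub, Matrix.sub_mul, Matrix.mul_assoc]
    rw [h5, hB]
  have hs := (Matrix.toEuclideanLin Y).singularValues_nonneg (Y.rank - 1)
  have h6 := hBC (E - E * (V * Vᵀ))
  have h7 := frobenius_sub_mul_projection_le hV E
  have h8 := frobenius_sub_projection_le hU E
  have h9 := Matrix.frobenius_norm_mul (E - U * Uᵀ * E) (B * (E - E * (V * Vᵀ)))
  rw [h4, h1, h3]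
  calc _ ≤ (Matrix.toEuclideanLin Y).singularValues (Y.rank - 1) *
        (‖E - U * Uᵀ * E‖ * ‖B * (E - E * (V * Vᵀ))‖) := mul_le_mul_of_nonneg_left h9 hs
    _ = ‖E - U * Uᵀ * E‖ * ((Matrix.toEuclideanLin Y).singularValues (Y.rank - 1) *
        ‖B * (E - E * (V * Vᵀ))‖) := by ring
    _ ≤ ‖E‖ * ‖E‖ := mul_le_mul h8 (h6.trans h7) (by positivity) (norm_nonneg _)
    _ = ‖E‖ ^ 2 := (sq _).symm

end TangentProjection

end MatrixLemmas

/-! ### Nearly isometric maps and the projected gradient step -/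

section InnerProductLemmas

variable {E F : Type*} [NormedAddCommGroup E] [InnerProductSpace ℝ E]
  [NormedAddCommGroup F] [InnerProductSpace ℝ F]

/-- A symmetric bilinear form whose quadratic form is bounded on a submodule is bounded there. -/
theorem abs_bilin_le_of_abs_quadratic_le (B : E →ₗ[ℝ] E →ₗ[ℝ] ℝ) (hB : ∀ x y, B x y = B y x)
    (S : Submodule ℝ E) {c : ℝ} (h : ∀ z ∈ S, |B z z| ≤ c * ‖z‖ ^ 2) {x y : E} (hx : x ∈ S)
    (hy : y ∈ S) : |B x y| ≤ c * ‖x‖ * ‖y‖ := by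
  have key : ∀ x ∈ S, ∀ y ∈ S, |B x y| ≤ c / 2 * (‖x‖ ^ 2 + ‖y‖ ^ 2) := by
    intro x hx y hy
    have h1 := abs_le.mp (h _ (S.add_mem hx hy))
    have h2 := abs_le.mp (h _ (S.sub_mem hx hy))
    have h3 : B (x + y) (x + y) - B (x - y) (x - y) = 4 * B x y := by
      simp only [map_add, map_sub, LinearMap.add_apply, LinearMap.sub_apply, hB y x]
      ring
    have h4 := parallelogram_law_with_norm ℝ x y
    have h5 : c * _ = c * _ := congrArg (c * ·) h4
    rw [abs_le]
    constructor <;> linarith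
  rcases eq_or_ne x 0 with rfl | hx0
  · simp
  rcases eq_or_ne y 0 with rfl | hy0
  · simp
  have hx1 : 0 < ‖x‖ := norm_pos_iff.mpr hx0
  have hy1 : 0 < ‖y‖ := norm_pos_iff.mpr hy0
  -- Rescaling gives both vectors the norm `‖x‖ ‖y‖`, which turns the sum of squares in `key` into
  -- the product.
  have h5 := key _ (S.smul_mem ‖y‖ hx) _ (S.smul_mem ‖x‖ hy)
  simp only [map_smul, LinearMap.smul_apply, smul_eq_mul, abs_mul, abs_norm, norm_smul,
    Real.norm_eq_abs] at h5
  have h6 : 0 < ‖x‖ * ‖y‖ := by positivity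
  nlinarith

/-- The bilinear form `(x, y) ↦ a ⟪x, y⟫ - b ⟪A x, A y⟫`. -/
def defectForm (A : E →ₗ[ℝ] F) (a b : ℝ) : E →ₗ[ℝ] E →ₗ[ℝ] ℝ :=
  a • innerₗ E - b • (innerₗ F).compl₁₂ A A

theorem defectForm_apply (A : E →ₗ[ℝ] F) (a b : ℝ) (x y : E) :
    defectForm A a b x y = a * inner ℝ x y - b * inner ℝ (A x) (A y) := by
  simp [defectForm]

theorem defectForm_comm (A : E →ₗ[ℝ] F) (a b : ℝ) (x y : E) :
    defectForm A a b x y = defectForm A a b y x := by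
  simp [defectForm_apply, real_inner_comm]

theorem abs_defectForm_le {A : E →ₗ[ℝ] F} {R : ℝ} {S : Submodule ℝ E}
    (h : ∀ z ∈ S, (1 - R) * ‖z‖ ^ 2 ≤ ‖A z‖ ^ 2 ∧ ‖A z‖ ^ 2 ≤ (1 + R) * ‖z‖ ^ 2) {x y : E}
    (hx : x ∈ S) (hy : y ∈ S) : |defectForm A 1 1 x y| ≤ R * ‖x‖ * ‖y‖ := by
  refine abs_bilin_le_of_abs_quadratic_le _ (defectForm_comm A 1 1) S (fun z hz => ?_) hx hy
  rw [defectForm_apply, real_inner_self_eq_norm_sq, real_inner_self_eq_norm_sq, abs_le]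
  constructor <;> linarith [(h z hz).1, (h z hz).2]

/-- For such `α` the ratio `α ‖A z‖² / ‖z‖²` lies between `(1 - R)/(1 + R)` and `(1 + R)/(1 - R)`,
hence within `2R/(1 - R)` of `1`. -/
theorem abs_defectForm_step_le {A : E →ₗ[ℝ] F} {R α : ℝ} (hR0 : 0 ≤ R) (hR1 : R < 1)
    (hα1 : 1 / (1 + R) ≤ α) (hα2 : α ≤ 1 / (1 - R)) {S : Submodule ℝ E}
    (h : ∀ z ∈ S, (1 - R) * ‖z‖ ^ 2 ≤ ‖A z‖ ^ 2 ∧ ‖A z‖ ^ 2 ≤ (1 + R) * ‖z‖ ^ 2) {x y : E}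
    (hx : x ∈ S) (hy : y ∈ S) : |defectForm A 1 α x y| ≤ 2 * R / (1 - R) * ‖x‖ * ‖y‖ := by
  refine abs_bilin_le_of_abs_quadratic_le _ (defectForm_comm A 1 α) S (fun z hz => ?_) hx hy
  rw [defectForm_apply, real_inner_self_eq_norm_sq, real_inner_self_eq_norm_sq, abs_le]
  obtain ⟨h1, h2⟩ := h z hz
  have hR2 : 0 < 1 - R := by linarith
  have hR3 : 0 < 1 + R := by linarith
  have hα0 : 0 < α := lt_of_lt_of_le (by positivity) hα1
  have h3 : α * ‖A z‖ ^ 2 ≤ 1 / (1 - R) * ((1 + R) * ‖z‖ ^ 2) := by gcongr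
  have h4 : 1 / (1 + R) * ((1 - R) * ‖z‖ ^ 2) ≤ α * ‖A z‖ ^ 2 := by gcongr
  have h5 : 1 / (1 - R) * ((1 + R) * ‖z‖ ^ 2) = ‖z‖ ^ 2 + 2 * R / (1 - R) * ‖z‖ ^ 2 := by
    field_simp
    ring
  have h6 : 1 / (1 + R) * ((1 - R) * ‖z‖ ^ 2) = ‖z‖ ^ 2 - 2 * R / (1 + R) * ‖z‖ ^ 2 := by
    field_simp
    ring
  have h7 : 2 * R / (1 + R) * ‖z‖ ^ 2 ≤ 2 * R / (1 - R) * ‖z‖ ^ 2 := by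
    gcongr
    linarith
  constructor <;> linarith

theorem norm_le_of_inner_self_le {v : E} {c : ℝ} (hc : 0 ≤ c) (h : inner ℝ v v ≤ c * ‖v‖) :
    ‖v‖ ≤ c := by
  rw [real_inner_self_eq_norm_sq] at h
  by_contra! hlt
  nlinarith

variable [FiniteDimensional ℝ E] [FiniteDimensional ℝ F]

/-- One gradient step in a linear space, restricted to the range of the orthogonal projection `P`
by `P`, for a map `A` that is nearly isometric there. -/
theorem norm_projected_step_le (A : E →ₗ[ℝ] F) (P : E →ₗ[ℝ] E) (hP : P.IsSymmetric)
    (hPP : ∀ x, P (P x) = P x) {R α : ℝ} (hR0 : 0 ≤ R) (hR1 : R < 1) (X T : E) (hX : P X = X)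
    (hRIP : ∀ (Z : E) (a : ℝ), (1 - R) * ‖P Z + a • (T - P T)‖ ^ 2 ≤
        ‖A (P Z + a • (T - P T))‖ ^ 2 ∧
      ‖A (P Z + a • (T - P T))‖ ^ 2 ≤ (1 + R) * ‖P Z + a • (T - P T)‖ ^ 2)
    (hα : α = ‖P (A.adjoint (A (T - X)))‖ ^ 2 / ‖A (P (A.adjoint (A (T - X))))‖ ^ 2) :
    ‖P (X + α • A.adjoint (A (T - X))) - T‖ ≤
      2 * R / (1 - R) * ‖X - T‖ + (R / (1 - R) + 1) * ‖T - P T‖ := by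
  have hR2 : 0 < 1 - R := by linarith
  have hR3 : 0 < 1 + R := by linarith
  set G := A.adjoint (A (T - X)) with hG
  -- If `P G = 0`, division by zero makes `α = 0`, outside the admissible interval. The step does
  -- not change when `1` is used instead.
  obtain ⟨β, hβ1, hβ2, hβ⟩ : ∃ β, 1 / (1 + R) ≤ β ∧ β ≤ 1 / (1 - R) ∧ α • P G = β • P G := by
    by_cases h0 : P G = 0
    · exact ⟨1, by rw [div_le_one hR3]; linarith, by rw [le_div_iff₀ hR2]; linarith, by simp [h0]⟩
    · have h1 : 0 < ‖P G‖ ^ 2 := by positivity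
      obtain ⟨h2, h3⟩ := hRIP G 0
      simp only [zero_smul, add_zero] at h2 h3
      have h4 : 0 < ‖A (P G)‖ ^ 2 := lt_of_lt_of_le (by positivity) h2
      refine ⟨α, ?_, ?_, rfl⟩
      · rw [hα, div_le_div_iff₀ hR3 h4]
        linarith
      · rw [hα, div_le_div_iff₀ h4 hR2]
        linarith
  have hβ0 : 0 < β := lt_of_lt_of_le (by positivity) hβ1
  set S := LinearMap.range P ⊔ Submodule.span ℝ {T - P T} with hS
  have hSR : ∀ z ∈ S, (1 - R) * ‖z‖ ^ 2 ≤ ‖A z‖ ^ 2 ∧ ‖A z‖ ^ 2 ≤ (1 + R) * ‖z‖ ^ 2 := by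
    intro z hz
    obtain ⟨y, ⟨x, rfl⟩, w, hw, rfl⟩ := Submodule.mem_sup.mp hz
    obtain ⟨a, rfl⟩ := Submodule.mem_span_singleton.mp hw
    exact hRIP x a
  have hmemP : ∀ x, P x ∈ S := fun x => Submodule.mem_sup_left ⟨x, rfl⟩
  have hmemN : T - P T ∈ S := Submodule.mem_sup_right (Submodule.mem_span_singleton_self _)
  have hPN : P (T - P T) = 0 := by rw [map_sub, hPP, sub_self]
  set D := P (X - T) with hD
  have hXT : X - T = D - (T - P T) := by rw [hD, map_sub, hX]; abel
  set v := D + β • P G with hv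
  have hPv : P v = v := by simp [hv, hD, hPP]
  have h1 : P (X + α • G) - T = v - (T - P T) := by
    rw [map_add, map_smul, hβ, hX, hv, hD, map_sub, hX]
    abel
  have hDn : ‖D‖ ≤ ‖X - T‖ := by
    have h2 : inner ℝ D (T - P T) = 0 := by
      rw [hD, hP, hPN, inner_zero_right]
    have h3 : ‖X - T‖ ^ 2 = ‖D‖ ^ 2 + ‖T - P T‖ ^ 2 := by
      rw [hXT, norm_sub_sq_real, h2]
      ring
    refine le_of_sq_le_sq ?_ (norm_nonneg _)
    nlinarith [sq_nonneg ‖T - P T‖]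
  have hvn : ‖v‖ ≤ 2 * R / (1 - R) * ‖D‖ + R / (1 - R) * ‖T - P T‖ := by
    refine norm_le_of_inner_self_le (by positivity) ?_
    have h4 : inner ℝ (P G) v = inner ℝ (A (T - P T)) (A v) - inner ℝ (A D) (A v) := by
      rw [hP, hPv, hG, LinearMap.adjoint_inner_left, ← inner_sub_left, ← map_sub,
        ← neg_sub X T, hXT]
      congr 2
      abel
    -- The first term is the defect of `1 - β A* A` on the tangent error `D`. The second is the
    -- leakage of the normal part into the tangent space, small because `T - P T` is orthogonal to
    -- `v`.
    have h5 : inner ℝ v v = defectForm A 1 β D v + β * inner ℝ (A (T - P T)) (A v) := by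
      conv_lhs => rw [hv, ← hv, inner_add_left, inner_smul_left]
      rw [h4, defectForm_apply]
      simp
      ring
    have h6 : inner ℝ (T - P T) v = 0 := by
      rw [← hPv, ← hP, hPN, inner_zero_left]
    have hvS : v ∈ S := hPv ▸ hmemP v
    have h7 := abs_defectForm_step_le hR0 hR1 hβ1 hβ2 hSR (hmemP (X - T)) hvS
    have h8 := abs_defectForm_le hSR hmemN hvS
    rw [defectForm_apply, h6] at h8
    have h9 : inner ℝ (A (T - P T)) (A v) ≤ R * ‖T - P T‖ * ‖v‖ := by
      linarith [(abs_le.mp h8).1]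
    have h10 : β * inner ℝ (A (T - P T)) (A v) ≤ 1 / (1 - R) * (R * ‖T - P T‖ * ‖v‖) :=
      (mul_le_mul_of_nonneg_left h9 hβ0.le).trans
        (mul_le_mul_of_nonneg_right hβ2 (by positivity))
    have h11 : 1 / (1 - R) * (R * ‖T - P T‖ * ‖v‖) = R / (1 - R) * ‖T - P T‖ * ‖v‖ := by ring
    rw [h5]
    have h12 := (abs_le.mp h7).2
    rw [← hD] at h12
    linarith
  rw [h1]
  have h13 := norm_sub_le v (T - P T)
  have h14 : 2 * R / (1 - R) * ‖D‖ ≤ 2 * R / (1 - R) * ‖X - T‖ :=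
    mul_le_mul_of_nonneg_left hDn (by positivity)
  linarith

/-- The quality of an approximation of `A* A T` that is at least as good as `T`. -/
theorem norm_sub_le_of_norm_sub_normal_le (A : E →ₗ[ℝ] F) {R : ℝ} (T Y : E)
    (hRIP : ∀ a b : ℝ, (1 - R) * ‖a • T + b • Y‖ ^ 2 ≤ ‖A (a • T + b • Y)‖ ^ 2 ∧
      ‖A (a • T + b • Y)‖ ^ 2 ≤ (1 + R) * ‖a • T + b • Y‖ ^ 2) (hR0 : 0 ≤ R)
    (h : ‖A.adjoint (A T) - Y‖ ≤ ‖A.adjoint (A T) - T‖) : ‖Y - T‖ ≤ 2 * R * ‖T‖ := by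
  refine norm_le_of_inner_self_le (by positivity) ?_
  set W := A.adjoint (A T) with hW
  have hS : ∀ z ∈ Submodule.span ℝ {T, Y},
      (1 - R) * ‖z‖ ^ 2 ≤ ‖A z‖ ^ 2 ∧ ‖A z‖ ^ 2 ≤ (1 + R) * ‖z‖ ^ 2 := by
    intro z hz
    obtain ⟨a, b, rfl⟩ := Submodule.mem_span_pair.mp hz
    exact hRIP a b
  have hT : T ∈ Submodule.span ℝ {T, Y} := Submodule.subset_span (by simp)
  have hY : Y ∈ Submodule.span ℝ {T, Y} := Submodule.subset_span (by simp)
  have h1 := abs_defectForm_le hS hT (Submodule.sub_mem _ hY hT)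
  rw [defectForm_apply] at h1
  have h2 : inner ℝ (A T) (A (Y - T)) = inner ℝ W (Y - T) := by
    rw [hW, LinearMap.adjoint_inner_left]
  rw [h2] at h1
  have h3 : ‖W - Y‖ ^ 2 ≤ ‖W - T‖ ^ 2 := pow_le_pow_left₀ (norm_nonneg _) h 2
  have h4 : W - Y = (W - T) - (Y - T) := by abel
  -- Expanding the square leaves `‖Y - T‖² ≤ 2 ⟪W - T, Y - T⟫`, and the right side is `-2` times the
  -- defect form at `(T, Y - T)`.
  rw [h4, norm_sub_sq_real, inner_sub_left] at h3
  rw [real_inner_self_eq_norm_sq]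
  linarith [(abs_le.mp h1).1]

end InnerProductLemmas

/-- The error recursion of the algorithm. -/
theorem error_recursion {D q ρ R γ t σ c : ℝ} {e h x ν : ℕ → ℝ} (hD : 0 ≤ D) (hq : 0 ≤ q)
    (hR0 : 0 ≤ R) (hR2 : R < 1 / 2) (hc : 0 ≤ c) (hσ : 0 < σ) (ht : 0 ≤ t) (he : ∀ k, 0 ≤ e k)
    (hh0 : ∀ k, 0 ≤ h k) (hρ : ρ = 2 * R / (1 - R) * (2 * (D + 1) + R))
    (hγ : γ = 2 * R / (1 - R) * (4 * c * (2 * (D + 1) + R) + q + 2)) (hγ1 : γ ≤ 1)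
    (htσ : t ≤ c * σ) (hhe : ∀ k, h k ≤ 2 * e k) (hxe : ∀ k, x k ≤ (q + 1) * e k)
    (hxh : ∀ k, x k ≤ (D + 1) * h k) (hνh : ∀ k, ν k ≤ h k) (hνσ : ∀ k, σ * ν k ≤ h k ^ 2)
    (hh : h 0 ≤ 2 * R * t)
    (hstep : ∀ k, e (k + 1) ≤ 2 * R / (1 - R) * x k + (R / (1 - R) + 1) * ν k) (k : ℕ) :
    e (k + 1) ≤ ρ * γ ^ k * t := by
  have hR1 : 0 < 1 - R := by linarith
  set u := R / (1 - R) with hu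
  have hu0 : 0 ≤ u := by positivity
  have hu2 : 2 * R / (1 - R) = 2 * u := by rw [hu]; ring
  have huR : u + 1 = 1 / (1 - R) := by rw [hu]; field_simp; ring
  have huR' : (u + 1) * R = u := by rw [huR, hu]; ring
  rw [hu2] at hρ hγ
  simp only [hu2] at hstep
  have hγ0 : 0 ≤ γ := by rw [hγ]; positivity
  have hρ0 : 0 ≤ ρ := by rw [hρ]; positivity
  induction k with
  | zero =>
    have h1 := hstep 0
    have h2 : x 0 ≤ (D + 1) * (2 * R * t) :=
      (hxh 0).trans (mul_le_mul_of_nonneg_left hh (by linarith))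
    have h3 : ν 0 ≤ 2 * R * t := (hνh 0).trans hh
    have h4 : 2 * u * x 0 ≤ 2 * u * ((D + 1) * (2 * R * t)) :=
      mul_le_mul_of_nonneg_left h2 (by positivity)
    have h5 : (u + 1) * ν 0 ≤ (u + 1) * (2 * R * t) :=
      mul_le_mul_of_nonneg_left h3 (by positivity)
    have h6 : (u + 1) * (2 * R * t) = 2 * u * t := by
      calc _ = 2 * ((u + 1) * R) * t := by ring
        _ = _ := by rw [huR']
    -- This is exactly the slack between `ρ t` and the bound `2 u t (2 R (D + 1) + 1)` given by the
    -- first step.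
    have h7 : 0 ≤ 2 * u * t * ((1 - R) * (2 * (D + 1) - 1)) := by
      have : 0 ≤ 2 * (D + 1) - 1 := by linarith
      positivity
    rw [hρ]
    simp only [zero_add, pow_zero, mul_one]
    nlinarith
  | succ k ih =>
    have hpow : γ ^ k ≤ 1 := pow_le_one₀ hγ0 hγ1
    have hek : e (k + 1) ≤ ρ * t := by
      refine ih.trans ?_
      have : ρ * t * γ ^ k ≤ ρ * t * 1 := mul_le_mul_of_nonneg_left hpow (by positivity)
      linarith
    have h1 := hstep (k + 1)
    set E := e (k + 1) with hE
    have hE0 : 0 ≤ E := he _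
    -- In `h²` one factor is bounded by `2 E` and the other by `2 ρ c σ`, so that `σ` cancels.
    have h2 : ν (k + 1) ≤ 4 * ρ * c * E := by
      have h3 : h (k + 1) ^ 2 ≤ (2 * E) * (2 * (ρ * (c * σ))) := by
        rw [sq]
        refine mul_le_mul (hhe _) ((hhe _).trans ?_) (hh0 _) (by positivity)
        have : ρ * t ≤ ρ * (c * σ) := mul_le_mul_of_nonneg_left htσ hρ0
        linarith
      have h4 : σ * ν (k + 1) ≤ σ * (4 * ρ * c * E) := (hνσ _).trans (h3.trans_eq (by ring))
      exact le_of_mul_le_mul_left h4 hσ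
    -- The part of the normal term with the small factor `u` uses this linear bound and only the
    -- rest uses the quadratic one. This yields the summands `q + 2` and `4 c (2 (D + 1) + R)` of
    -- `γ`.
    have h3 : ν (k + 1) ≤ 2 * E := (hνh _).trans (hhe _)
    have h4 : 2 * u * x (k + 1) ≤ 2 * u * ((q + 1) * E) :=
      mul_le_mul_of_nonneg_left (hxe _) (by positivity)
    have h5 : u * ν (k + 1) ≤ u * (2 * E) := mul_le_mul_of_nonneg_left h3 hu0
    have h6 : e (k + 1 + 1) ≤ γ * E := by
      rw [hρ] at h2
      rw [hγ]
      linarith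
    calc _ ≤ γ * E := h6
      _ ≤ γ * (ρ * γ ^ k * t) := mul_le_mul_of_nonneg_left ih hγ0
      _ = _ := by ring

/-! ### Unfoldings of multilinear products -/

section TuckerProducts

open Matrix

attribute [local instance] Matrix.frobeniusNormedAddCommGroup

variable {n p r : Fin d → ℕ}

theorem unfold_add (k : Fin d) (X Y : Tensor n) : unfold k (X + Y) = unfold k X + unfold k Y := rfl

theorem unfold_sub (k : Fin d) (X Y : Tensor n) : unfold k (X - Y) = unfold k X - unfold k Y := rfl

theorem unfold_smul (k : Fin d) (a : ℝ) (X : Tensor n) : unfold k (a • X) = a • unfold k X := rfl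

theorem unfold_injective (k : Fin d) : Function.Injective (unfold (n := n) k) :=
  Function.LeftInverse.injective (refold_unfold k)

theorem norm_unfold (k : Fin d) (X : Tensor n) : ‖unfold k X‖ = ‖X‖ := by
  rw [← sq_eq_sq₀ (norm_nonneg _) (norm_nonneg _), frobenius_sq_eq_sum, EuclideanSpace.norm_sq_eq,
    ← Fintype.sum_prod_type', ← Equiv.sum_comp (Equiv.piSplitAt k fun j => Fin (n j)).symm]
  simp [unfold]

/-- The Kronecker product of the matrices for all the modes other than `k`. -/
def otherKron (k : Fin d) (M : (i : Fin d) → Matrix (Fin (p i)) (Fin (n i)) ℝ) :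
    Matrix (ColIdx p k) (ColIdx n k) ℝ :=
  Matrix.of fun a b => ∏ j : {j : Fin d // j ≠ k}, M j (a j) (b j)

theorem otherKron_congr {k : Fin d} {M N : (i : Fin d) → Matrix (Fin (p i)) (Fin (n i)) ℝ}
    (h : ∀ j, j ≠ k → M j = N j) : otherKron k M = otherKron k N := by
  ext a b
  simp only [otherKron, Matrix.of_apply]
  refine Finset.prod_congr rfl fun j _ => ?_
  rw [h j j.2]

theorem otherKron_mul {q : Fin d → ℕ} (k : Fin d)
    (M : (i : Fin d) → Matrix (Fin (q i)) (Fin (p i)) ℝ)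
    (N : (i : Fin d) → Matrix (Fin (p i)) (Fin (n i)) ℝ) :
    otherKron k M * otherKron k N = otherKron k fun i => M i * N i := by
  ext a b
  simp only [otherKron, Matrix.mul_apply, Matrix.of_apply, ← Finset.prod_mul_distrib]
  rw [Finset.prod_univ_sum, Fintype.piFinset_univ]

theorem otherKron_transpose (k : Fin d) (M : (i : Fin d) → Matrix (Fin (p i)) (Fin (n i)) ℝ) :
    (otherKron k M)ᵀ = otherKron k fun i => (M i)ᵀ := rfl

theorem otherKron_one (k : Fin d) :
    otherKron k (fun i => (1 : Matrix (Fin (n i)) (Fin (n i)) ℝ)) = 1 := by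
  ext a b
  by_cases h : a = b
  · subst h
    simp [otherKron]
  · obtain ⟨j, hj⟩ := Function.ne_iff.mp h
    rw [Matrix.one_apply_ne h]
    exact Finset.prod_eq_zero (Finset.mem_univ j) (Matrix.one_apply_ne hj)

theorem unfold_tuckerMul (k : Fin d) (M : (i : Fin d) → Matrix (Fin (p i)) (Fin (n i)) ℝ)
    (X : Tensor n) : unfold k (tuckerMul M X) = M k * unfold k X * (otherKron k M)ᵀ := by
  ext a b
  have h1 : ∀ {n : Fin d → ℕ} (x : Fin (n k)) (y : ColIdx n k),
      (Equiv.piSplitAt k fun j => Fin (n j)).symm (x, y) k = x := by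
    intro n x y
    simp [Equiv.piSplitAt]
  have h2 : ∀ {n : Fin d → ℕ} (x : Fin (n k)) (y : ColIdx n k) (j : {j : Fin d // j ≠ k}),
      (Equiv.piSplitAt k fun j => Fin (n j)).symm (x, y) j = y j := by
    intro n x y j
    simp [Equiv.piSplitAt, j.2]
  have h3 : unfold k (tuckerMul M X) a b = ∑ c : (i : Fin d) → Fin (n i),
      (∏ i, M i ((Equiv.piSplitAt k fun j => Fin (p j)).symm (a, b) i) (c i)) * X c := rfl
  rw [h3, ← Equiv.sum_comp (Equiv.piSplitAt k fun j => Fin (n j)).symm, Fintype.sum_prod_type,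
    Finset.sum_comm]
  simp only [Matrix.mul_apply, Finset.sum_mul]
  refine Finset.sum_congr rfl fun y _ => Finset.sum_congr rfl fun x _ => ?_
  rw [Fintype.prod_eq_mul_prod_subtype_ne _ k]
  simp only [h1, h2, otherKron, unfold, Matrix.transpose_apply, Matrix.of_apply]
  ring

theorem tuckerMul_tuckerMul {q : Fin d → ℕ} [NeZero d]
    (M : (i : Fin d) → Matrix (Fin (q i)) (Fin (p i)) ℝ)
    (N : (i : Fin d) → Matrix (Fin (p i)) (Fin (n i)) ℝ) (X : Tensor n) :
    tuckerMul M (tuckerMul N X) = tuckerMul (fun i => M i * N i) X := by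
  apply unfold_injective 0
  simp only [unfold_tuckerMul, ← otherKron_mul, Matrix.transpose_mul, Matrix.mul_assoc]

theorem tuckerMul_one [NeZero d] (X : Tensor n) :
    tuckerMul (fun i => (1 : Matrix (Fin (n i)) (Fin (n i)) ℝ)) X = X := by
  apply unfold_injective 0
  rw [unfold_tuckerMul, otherKron_one, Matrix.transpose_one, Matrix.mul_one, Matrix.one_mul]

theorem inner_tuckerMul (M : (i : Fin d) → Matrix (Fin (p i)) (Fin (n i)) ℝ)
    (X : Tensor n) (Y : Tensor p) :
    inner ℝ (tuckerMul M X) Y = inner ℝ X (tuckerMul (fun i => (M i)ᵀ) Y) := by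
  simp only [PiLp.inner_apply, tuckerMul, RCLike.inner_apply, conj_trivial, Finset.mul_sum,
    Finset.sum_mul, Matrix.transpose_apply]
  rw [Finset.sum_comm]
  exact Finset.sum_congr rfl fun x _ => Finset.sum_congr rfl fun y _ => by ring

/-- The orthogonal projection onto the column space of `U_i` in each of the first `t` modes. -/
def partialProj (U : (i : Fin d) → Matrix (Fin (n i)) (Fin (r i)) ℝ) (t : ℕ) (j : Fin d) :
    Matrix (Fin (n j)) (Fin (n j)) ℝ :=
  if j.val < t then U j * (U j)ᵀ else 1

/-! ### Nested mode-wise projections -/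

section Projections

variable {U : (i : Fin d) → Matrix (Fin (n i)) (Fin (r i)) ℝ}

theorem partialProj_of_lt {t : ℕ} {j : Fin d} (h : j.val < t) :
    partialProj U t j = U j * (U j)ᵀ := if_pos h

theorem partialProj_of_le {t : ℕ} {j : Fin d} (h : t ≤ j.val) : partialProj U t j = 1 :=
  if_neg h.not_gt

theorem partialProj_transpose (t : ℕ) (j : Fin d) :
    (partialProj U t j)ᵀ = partialProj U t j := by
  unfold partialProj
  split_ifs <;> simp

theorem partialProj_mul (hU : ∀ i, (U i)ᵀ * U i = 1) {a b : ℕ} (hab : a ≤ b) (j : Fin d) :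
    partialProj U a j * partialProj U b j = partialProj U b j := by
  rcases lt_or_ge j.val a with h | h
  · rw [partialProj_of_lt h, partialProj_of_lt (h.trans_le hab), Matrix.mul_assoc,
      ← Matrix.mul_assoc (U j)ᵀ, hU, Matrix.one_mul]
  · rw [partialProj_of_le h, Matrix.one_mul]

theorem tuckerApprox_eq_partialProj [NeZero d] (Z : Tensor n) :
    tuckerApprox U Z = tuckerMul (partialProj U d) Z := by
  rw [tuckerApprox, tuckerMul_tuckerMul]
  congr 1
  ext1 i
  exact (partialProj_of_lt i.2).symm

theorem tuckerMul_partialProj_zero [NeZero d] (Z : Tensor n) :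
    tuckerMul (partialProj U 0) Z = Z := by
  rw [show partialProj U 0 = fun i => 1 from funext fun i => partialProj_of_le (Nat.zero_le _),
    tuckerMul_one]

theorem norm_sq_partialProj_sub [NeZero d] (hU : ∀ i, (U i)ᵀ * U i = 1) {a b : ℕ} (hab : a ≤ b)
    (Z : Tensor n) : ‖tuckerMul (partialProj U a) Z - tuckerMul (partialProj U b) Z‖ ^ 2 =
      ‖tuckerMul (partialProj U a) Z‖ ^ 2 - ‖tuckerMul (partialProj U b) Z‖ ^ 2 := by
  have h : ∀ {a : ℕ}, a ≤ b → inner ℝ (tuckerMul (partialProj U a) Z)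
      (tuckerMul (partialProj U b) Z) = inner ℝ Z (tuckerMul (partialProj U b) Z) := by
    intro a hab
    rw [inner_tuckerMul, tuckerMul_tuckerMul]
    simp only [partialProj_transpose, partialProj_mul hU hab]
  rw [norm_sub_sq_real, h hab, ← h le_rfl, real_inner_self_eq_norm_sq]
  ring

/-- The projections for increasing `t` are nested, so by Pythagoras each squared difference is a
difference of squared norms, and these telescope. -/
theorem norm_sq_partialProj_sub_eq_sum [NeZero d] (hU : ∀ i, (U i)ᵀ * U i = 1) {a b : ℕ}
    (hab : a ≤ b) (Z : Tensor n) :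
    ‖tuckerMul (partialProj U a) Z - tuckerMul (partialProj U b) Z‖ ^ 2 = ∑ t ∈ Finset.Ico a b,
      ‖tuckerMul (partialProj U t) Z - tuckerMul (partialProj U (t + 1)) Z‖ ^ 2 := by
  simp only [norm_sq_partialProj_sub hU hab, norm_sq_partialProj_sub hU (Nat.le_succ _)]
  induction b, hab using Nat.le_induction with
  | base => simp
  | succ b hab ih => rw [Finset.sum_Ico_succ_top hab, ← ih]; ring

end Projections

/-! ### Quasi-optimality of the ST-HOSVD -/

section SequentiallyTruncatedHOSVD

variable {U : (i : Fin d) → Matrix (Fin (n i)) (Fin (r i)) ℝ}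

theorem stFactor_of_lt {i j : Fin d} (h : j < i) :
    stFactor U i j = (U j)ᵀ.submatrix (Fin.cast (stDim_of_lt h)) id := dif_pos h

theorem stFactor_of_not_lt {i j : Fin d} (h : ¬ j < i) :
    stFactor U i j = (1 : Matrix (Fin (n j)) (Fin (n j)) ℝ).submatrix
      (Fin.cast (stDim_of_not_lt h)) id := dif_neg h

theorem submatrix_cast_gram {a b c : ℕ} (h : a = b) (M : Matrix (Fin b) (Fin c) ℝ) :
    (M.submatrix (Fin.cast h) id)ᵀ * M.submatrix (Fin.cast h) id = Mᵀ * M := by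
  subst h
  rfl

theorem submatrix_cast_mul_transpose {a b c : ℕ} (h : a = b) (M : Matrix (Fin b) (Fin c) ℝ)
    (hM : M * Mᵀ = 1) : M.submatrix (Fin.cast h) id * (M.submatrix (Fin.cast h) id)ᵀ = 1 := by
  subst h
  exact hM

theorem submatrix_cast_cast {a b c : ℕ} (h : a = b) {γ : Type*} [Fintype γ]
    (M : Matrix (Fin b) (Fin c) ℝ) (Z : Matrix (Fin c) γ ℝ) :
    (M.submatrix (Fin.cast h) id * Z).submatrix (Fin.cast h.symm) id = M * Z := by
  subst h
  rfl

theorem stFactor_gram (i j : Fin d) :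
    (stFactor U i j)ᵀ * stFactor U i j = partialProj U i j := by
  by_cases h : j < i
  · rw [stFactor_of_lt h, submatrix_cast_gram, partialProj_of_lt h, transpose_transpose]
  · rw [stFactor_of_not_lt h, submatrix_cast_gram, partialProj_of_le (not_lt.mp h)]
    simp

theorem stFactor_mul_transpose (hU : ∀ i, (U i)ᵀ * U i = 1) (i j : Fin d) :
    stFactor U i j * (stFactor U i j)ᵀ = 1 := by
  by_cases h : j < i
  · rw [stFactor_of_lt h]
    exact submatrix_cast_mul_transpose _ _ (by rw [transpose_transpose, hU])
  · rw [stFactor_of_not_lt h]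
    exact submatrix_cast_mul_transpose _ _ (by simp)

theorem stFactor_mul_partialProj (hU : ∀ i, (U i)ᵀ * U i = 1) {i : Fin d} {t : ℕ}
    (ht : t ≤ i.val) (j : Fin d) : stFactor U i j * partialProj U t j = stFactor U i j := by
  have h : stFactor U i j = stFactor U i j * partialProj U i j := by
    rw [← stFactor_gram, ← Matrix.mul_assoc, stFactor_mul_transpose hU, Matrix.one_mul]
  have h2 : partialProj U i j * partialProj U t j = partialProj U i j := by
    have := congrArg Matrix.transpose (partialProj_mul hU ht j)
    simpa only [transpose_mul, partialProj_transpose] using this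
  rw [h, Matrix.mul_assoc, h2]

theorem unfold_stTensor (i : Fin d) (Z : Tensor n) :
    (unfold i (stTensor U i Z)).submatrix (Fin.cast (stDim_self n r i).symm) id =
      unfold i Z * (otherKron i (stFactor U i))ᵀ := by
  rw [stTensor, unfold_tuckerMul, stFactor_of_not_lt (lt_irrefl i), Matrix.mul_assoc,
    submatrix_cast_cast, Matrix.one_mul]

theorem IsSTHOSVD.orthonormal {Z : Tensor n} (h : IsSTHOSVD Z U) (i : Fin d) :
    (U i)ᵀ * U i = 1 := by
  obtain ⟨s, V, h⟩ := h i
  exact h.left_orthonormal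

/-- Up to an isometry the mode-`i` increment is the truncation error of the compressed unfolding.
Eckart–Young compares it with the equally compressed `T`, whose rank has not grown, and compression
is a contraction. Any `Z` with the same compression as `W` may stand for `W`; the later choice is an
earlier partial projection. -/
theorem IsSTHOSVD.norm_step_le {W : Tensor n} (h : IsSTHOSVD W U) (i : Fin d) {T Z : Tensor n}
    (hT : (unfold i T).rank ≤ r i)
    (hZ : unfold i Z * (otherKron i (stFactor U i))ᵀ =
      unfold i W * (otherKron i (stFactor U i))ᵀ) :
    ‖tuckerMul (partialProj U i) W - tuckerMul (partialProj U (i + 1)) W‖ ≤ ‖Z - T‖ := by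
  have hU := h.orthonormal
  obtain ⟨s, V, hsvd⟩ := h i
  rw [unfold_stTensor] at hsvd
  set K := otherKron i (stFactor U i) with hK
  have hKK : Kᵀᵀ * Kᵀ = 1 := by
    rw [transpose_transpose, hK, otherKron_transpose, otherKron_mul]
    simp only [stFactor_mul_transpose hU]
    exact otherKron_one i
  have hP : (otherKron i (partialProj U i))ᵀ = Kᵀ * K := by
    rw [hK, otherKron_transpose, otherKron_transpose, otherKron_mul]
    simp only [stFactor_gram, partialProj_transpose]
  have hP' : otherKron i (partialProj U (i + 1)) = otherKron i (partialProj U i) := by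
    refine otherKron_congr fun j hj => ?_
    have : j.val ≠ i.val := fun h => hj (Fin.ext h)
    unfold partialProj
    congr 1
    rw [eq_iff_iff]
    omega
  have h1 : unfold i (tuckerMul (partialProj U i) W - tuckerMul (partialProj U (i + 1)) W) =
      (unfold i W * Kᵀ - U i * (U i)ᵀ * (unfold i W * Kᵀ)) * Kᵀᵀ := by
    rw [unfold_sub, unfold_tuckerMul, unfold_tuckerMul, hP', hP, partialProj_of_le le_rfl,
      partialProj_of_lt (Nat.lt_succ_self _), Matrix.one_mul, transpose_transpose]
    simp only [Matrix.sub_mul, Matrix.mul_assoc]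
  rw [← norm_unfold i, h1, frobenius_mul_orthonormal_transpose hKK]
  refine (hsvd.frobenius_sub_projection_le
    ((Matrix.rank_mul_le_left (unfold i T) Kᵀ).trans hT)).trans ?_
  rw [← hZ, ← Matrix.sub_mul, ← unfold_sub]
  exact (frobenius_mul_orthonormal_le hKK _).trans (norm_unfold i _).le

/-- Quasi-optimality of the sequentially truncated HOSVD, from the stage at which the first `a`
modes have been truncated. -/
theorem IsSTHOSVD.norm_sub_tuckerApprox_le [NeZero d] {W T : Tensor n} (h : IsSTHOSVD W U)
    (hT : ∀ i, (unfold i T).rank ≤ r i) {a : ℕ} (ha : a ≤ d) :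
    ‖tuckerMul (partialProj U a) W - tuckerApprox U W‖ ≤
      √((d : ℝ) - a) * ‖tuckerMul (partialProj U a) W - T‖ := by
  have hda : (0 : ℝ) ≤ (d : ℝ) - a := by
    rw [sub_nonneg]
    exact_mod_cast ha
  refine le_of_sq_le_sq ?_ (by positivity)
  rw [mul_pow, Real.sq_sqrt hda, tuckerApprox_eq_partialProj,
    norm_sq_partialProj_sub_eq_sum h.orthonormal ha]
  -- There are `d - a` orthogonal increments, each bounded by the same distance to `T`; hence the
  -- factor `√(d - a)`.
  refine (Finset.sum_le_card_nsmul _ _ (‖tuckerMul (partialProj U a) W - T‖ ^ 2)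
    fun t ht => ?_).trans ?_
  · obtain ⟨hat, htd⟩ := Finset.mem_Ico.mp ht
    refine pow_le_pow_left₀ (norm_nonneg _) (h.norm_step_le ⟨t, htd⟩ (hT _) ?_) 2
    rw [unfold_tuckerMul, partialProj_of_le hat, Matrix.one_mul, Matrix.mul_assoc,
      ← transpose_mul, otherKron_mul]
    simp only [stFactor_mul_partialProj h.orthonormal (i := ⟨t, htd⟩) hat]
  · rw [Nat.card_Ico, nsmul_eq_mul, Nat.cast_sub ha]

end SequentiallyTruncatedHOSVD

end TuckerProducts

/-! ### The first-mode tangent projection on tensors -/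

section TangentSpace

open Matrix

attribute [local instance] Matrix.frobeniusNormedAddCommGroup

section MatrixRank

variable {m c : Type} [Fintype m] [Fintype c] {q : ℕ}

theorem rank_smul_le (a : ℝ) (M : Matrix m c ℝ) : (a • M).rank ≤ M.rank := by
  classical
  have h : a • M = (a • (1 : Matrix m m ℝ)) * M := by rw [Matrix.smul_mul, Matrix.one_mul]
  rw [h]
  exact Matrix.rank_mul_le_right _ _

theorem rank_add_le {m c : Type*} [Fintype c] (M N : Matrix m c ℝ) : (M + N).rank ≤ M.rank + N.rank := by
  unfold Matrix.rank
  rw [Matrix.mulVecLin_add]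
  refine (Submodule.finrank_mono ?_).trans (Submodule.finrank_add_le_finrank_add_finrank
    M.mulVecLin.range N.mulVecLin.range)
  rintro _ ⟨x, rfl⟩
  exact Submodule.add_mem_sup ⟨x, rfl⟩ ⟨x, rfl⟩

theorem rank_mul_le_width {m c : Type*} [Fintype c] (U : Matrix m (Fin q) ℝ) (A : Matrix (Fin q) c ℝ) :
    (U * A).rank ≤ q :=
  (Matrix.rank_mul_le_left _ _).trans ((Matrix.rank_le_card_width U).trans_eq (Fintype.card_fin q))

theorem rank_tangentProj_le (U : Matrix m (Fin q) ℝ) (V : Matrix c (Fin q) ℝ)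
    (Y : Matrix m c ℝ) : (tangentProj U V Y).rank ≤ q + q := by
  have h : tangentProj U V Y = U * (Uᵀ * Y) + ((Y * V) - U * (Uᵀ * Y * V)) * Vᵀ := by
    simp only [tangentProj, Matrix.sub_mul, Matrix.mul_assoc]
    abel
  rw [h]
  exact (rank_add_le _ _).trans (add_le_add (rank_mul_le_width _ _)
    ((Matrix.rank_mul_le_right _ _).trans ((Matrix.rank_le_card_height _).trans_eq (Fintype.card_fin q))))

theorem rank_sub_tangentProj_le (U : Matrix m (Fin q) ℝ) (V : Matrix c (Fin q) ℝ)
    (Y : Matrix m c ℝ) : (Y - tangentProj U V Y).rank ≤ Y.rank := by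
  classical
  have h : Y - tangentProj U V Y = (1 - U * Uᵀ) * (Y * (1 - V * Vᵀ)) := by
    simp only [sub_tangentProj, Matrix.sub_mul, Matrix.mul_sub, Matrix.one_mul, Matrix.mul_one,
      Matrix.mul_assoc]
  rw [h]
  exact (Matrix.rank_mul_le_right _ _).trans (Matrix.rank_mul_le_left _ _)

theorem tangentProj_tangentProj {U : Matrix m (Fin q) ℝ} {V : Matrix c (Fin q) ℝ}
    (hU : Uᵀ * U = 1) (hV : Vᵀ * V = 1) (Y : Matrix m c ℝ) :
    tangentProj U V (tangentProj U V Y) = tangentProj U V Y := by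
  have hp : ∀ Z : Matrix m c ℝ, U * Uᵀ * (U * Uᵀ * Z) = U * Uᵀ * Z := fun Z => by
    rw [Matrix.mul_assoc U Uᵀ, ← Matrix.mul_assoc Uᵀ, ← Matrix.mul_assoc Uᵀ, hU, Matrix.one_mul,
      Matrix.mul_assoc U]
  have hq : V * Vᵀ * (V * Vᵀ) = V * Vᵀ := by
    rw [Matrix.mul_assoc V Vᵀ, ← Matrix.mul_assoc Vᵀ, hV, Matrix.one_mul]
  unfold tangentProj
  generalize V * Vᵀ = Q at *
  generalize U * Uᵀ = P at *
  simp only [Matrix.mul_add, Matrix.mul_sub, Matrix.add_mul, Matrix.sub_mul, Matrix.mul_assoc, hp,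
    hq]
  abel

theorem trace_transpose_tangentProj_mul (U : Matrix m (Fin q) ℝ) (V : Matrix c (Fin q) ℝ)
    (Y Z : Matrix m c ℝ) :
    ((tangentProj U V Y)ᵀ * Z).trace = (Yᵀ * tangentProj U V Z).trace := by
  have hp : (U * Uᵀ)ᵀ = U * Uᵀ := by rw [transpose_mul, transpose_transpose]
  have hq : (V * Vᵀ)ᵀ = V * Vᵀ := by rw [transpose_mul, transpose_transpose]
  unfold tangentProj
  generalize V * Vᵀ = Q at *
  generalize U * Uᵀ = P at *
  simp only [transpose_add, transpose_sub, transpose_mul, hp, hq, Matrix.add_mul, Matrix.sub_mul,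
    Matrix.mul_add, Matrix.mul_sub, trace_add, trace_sub]
  have h1 : ∀ A : Matrix c c ℝ, (Q * A).trace = (A * Q).trace := fun A => trace_mul_comm _ _
  simp only [Matrix.mul_assoc, h1]

end MatrixRank

variable {n r : Fin d → ℕ} {q : ℕ}

theorem inner_eq_trace_unfold (k : Fin d) (X Y : Tensor n) :
    inner ℝ X Y = ((unfold k X)ᵀ * unfold k Y).trace := by
  rw [PiLp.inner_apply, ← Equiv.sum_comp (Equiv.piSplitAt k fun j => Fin (n j)).symm,
    Fintype.sum_prod_type, Finset.sum_comm]
  simp [Matrix.trace, Matrix.mul_apply, unfold, mul_comm]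

variable [NeZero d]

/-- The single-mode tangent space projection as a linear map. -/
def modeTangentProjLin (U : Matrix (Fin (n 0)) (Fin q) ℝ) (V : Matrix (ColIdx n 0) (Fin q) ℝ) :
    Tensor n →ₗ[ℝ] Tensor n where
  toFun := modeTangentProj U V
  map_add' X Y := by
    apply unfold_injective 0
    simp only [unfold_add, modeTangentProj, unfold_refold, tangentProj, Matrix.mul_add,
      Matrix.add_mul]
    abel
  map_smul' a X := by
    apply unfold_injective 0
    simp only [unfold_smul, modeTangentProj, unfold_refold, tangentProj, Matrix.mul_smul,
      Matrix.smul_mul, smul_add, smul_sub, RingHom.id_apply]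

variable {U : Matrix (Fin (n 0)) (Fin q) ℝ} {V : Matrix (ColIdx n 0) (Fin q) ℝ}

theorem modeTangentProjLin_apply (Z : Tensor n) :
    modeTangentProjLin U V Z = modeTangentProj U V Z := rfl

theorem unfold_modeTangentProj (Z : Tensor n) :
    unfold 0 (modeTangentProj U V Z) = tangentProj U V (unfold 0 Z) := unfold_refold _ _

theorem modeTangentProjLin_isSymmetric : (modeTangentProjLin U V).IsSymmetric := fun X Y => by
  rw [inner_eq_trace_unfold 0, inner_eq_trace_unfold 0]
  rw [modeTangentProjLin_apply, modeTangentProjLin_apply, unfold_modeTangentProj,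
    unfold_modeTangentProj, trace_transpose_tangentProj_mul]

/-- Tangent elements have rank at most `2 q` and the normal part of `T` at most `q`; this is why
isometry is required up to rank `3 r₁`. -/
theorem rank_tangent_add_normal_le {T : Tensor n} (hT : (unfold 0 T).rank ≤ q) (Z : Tensor n)
    (a : ℝ) :
    (unfold 0 (modeTangentProj U V Z + a • (T - modeTangentProj U V T))).rank ≤ 3 * q := by
  rw [unfold_add, unfold_smul, unfold_sub, unfold_modeTangentProj, unfold_modeTangentProj]
  have h1 := rank_tangentProj_le U V (unfold 0 Z)
  have h2 := (rank_smul_le a _).trans (rank_sub_tangentProj_le U V (unfold 0 T))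
  have h3 := rank_add_le (tangentProj U V (unfold 0 Z))
    (a • (unfold 0 T - tangentProj U V (unfold 0 T)))
  omega

theorem norm_sub_modeTangentProj_le (hU : Uᵀ * U = 1) (hV : Vᵀ * V = 1) (T Y : Tensor n)
    (S : Matrix (Fin q) (Fin q) ℝ) (hY : Y = refold 0 (U * S * Vᵀ)) :
    ‖T - modeTangentProj U V T‖ ≤ ‖Y - T‖ := by
  rw [← norm_unfold 0, ← norm_unfold 0 (Y - T), ← norm_neg (unfold 0 (Y - T)), unfold_sub,
    unfold_sub, unfold_modeTangentProj, neg_sub]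
  exact frobenius_sub_tangentProj_le hU hV _ _ S (by rw [hY, unfold_refold])

theorem singularValue_mul_norm_sub_modeTangentProj_le (hU : Uᵀ * U = 1) (hV : Vᵀ * V = 1)
    (T Y : Tensor n) (S : Matrix (Fin q) (Fin q) ℝ) (hY : Y = refold 0 (U * S * Vᵀ)) :
    (Matrix.toEuclideanLin (unfold 0 T)).singularValues ((unfold 0 T).rank - 1) *
      ‖T - modeTangentProj U V T‖ ≤ ‖Y - T‖ ^ 2 := by
  rw [← norm_unfold 0, ← norm_unfold 0 (Y - T), ← norm_neg (unfold 0 (Y - T)), unfold_sub,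
    unfold_sub, unfold_modeTangentProj, neg_sub]
  exact frobenius_sub_tangentProj_le_sq hU hV _ _ S (by rw [hY, unfold_refold])

theorem modeTangentProj_eq_self {U : (i : Fin d) → Matrix (Fin (n i)) (Fin (r i)) ℝ}
    {V : Matrix (ColIdx n 0) (Fin (r 0)) ℝ} (hU : (U 0)ᵀ * U 0 = 1) (Z : Tensor n) :
    modeTangentProj (U 0) V (tuckerApprox U Z) = tuckerApprox U Z := by
  apply unfold_injective 0
  have h : U 0 * (U 0)ᵀ * unfold 0 (tuckerApprox U Z) = unfold 0 (tuckerApprox U Z) := by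
    rw [tuckerApprox, unfold_tuckerMul, Matrix.mul_assoc (U 0) (U 0)ᵀ,
      ← Matrix.mul_assoc (U 0)ᵀ, ← Matrix.mul_assoc (U 0)ᵀ, hU, Matrix.one_mul, ← Matrix.mul_assoc]
  rw [unfold_modeTangentProj, tangentProj, h]
  abel

/-- Identifies `Xhat` with the ST-HOSVD stage after one mode, leaving `d - 1` truncations to reach
`X`. Only the left factor `U 0` matters, so the right factors of the two SVDs need not agree. -/
theorem refold_eq_partialProj_one {U : (i : Fin d) → Matrix (Fin (n i)) (Fin (r i)) ℝ}
    {s : Fin (r 0) → ℝ} {V : Matrix (ColIdx n 0) (Fin (r 0)) ℝ} {W : Tensor n}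
    (h : IsTruncatedSVD (unfold 0 W) (U 0) s V) :
    refold 0 (U 0 * Matrix.diagonal s * Vᵀ) = tuckerMul (partialProj U 1) W := by
  apply unfold_injective 0
  have h1 : otherKron 0 (partialProj U 1) = 1 := by
    rw [← otherKron_one]
    exact otherKron_congr fun j hj => partialProj_of_le
      (Nat.one_le_iff_ne_zero.mpr fun h => hj (Fin.ext (by simpa using h)))
  rw [unfold_refold, unfold_tuckerMul, h1, Matrix.transpose_one, Matrix.mul_one,
    partialProj_of_lt (by simp), h.projection_mul]

theorem IsTruncatedSVD.norm_sub_refold_le {U : Matrix (Fin (n 0)) (Fin q) ℝ} {s : Fin q → ℝ}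
    {V : Matrix (ColIdx n 0) (Fin q) ℝ} {W T : Tensor n}
    (h : IsTruncatedSVD (unfold 0 W) U s V) (hT : (unfold 0 T).rank ≤ q) :
    ‖W - refold 0 (U * Matrix.diagonal s * Vᵀ)‖ ≤ ‖W - T‖ := by
  rw [← norm_unfold 0, ← norm_unfold 0 (W - T), unfold_sub, unfold_sub, unfold_refold,
    ← h.projection_mul]
  exact h.frobenius_sub_projection_le hT

theorem norm_le_sqrt_rank_mul_condNumber (T : Tensor n) (hT : T ≠ 0) :
    0 < (Matrix.toEuclideanLin (unfold 0 T)).singularValues ((unfold 0 T).rank - 1) ∧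
      0 < (unfold 0 T).rank ∧ 0 ≤ condNumber (unfold 0 T) (unfold 0 T).rank ∧
      ‖T‖ ≤ √((unfold 0 T).rank : ℝ) * condNumber (unfold 0 T) (unfold 0 T).rank *
        (Matrix.toEuclideanLin (unfold 0 T)).singularValues ((unfold 0 T).rank - 1) := by
  have h0 := frobenius_le_sqrt_rank_mul (unfold 0 T)
  rw [norm_unfold] at h0
  have hr : 0 < (unfold 0 T).rank := by
    by_contra! h
    rw [Nat.le_zero.mp h] at h0
    simp only [Nat.cast_zero, Real.sqrt_zero, zero_mul, norm_le_zero_iff] at h0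
    exact hT h0
  set L := Matrix.toEuclideanLin (unfold 0 T) with hL
  have hσ : 0 < L.singularValues ((unfold 0 T).rank - 1) :=
    L.singularValues_pos_iff_lt_finrank_range.mpr (by rw [rank_toEuclideanLin_range]; omega)
  refine ⟨hσ, hr, div_nonneg (L.singularValues_nonneg _) hσ.le, ?_⟩
  rw [condNumber, ← hL, mul_assoc, div_mul_cancel₀ _ hσ.ne']
  exact h0

end TangentSpace

/-- The bound on the restricted isometry constant makes the contraction factor small. -/
theorem contraction_factor_lt_one {D q c R : ℝ} (hD : 0 ≤ D) (hq : 0 ≤ q) (hc : 0 ≤ c)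
    (hR0 : 0 ≤ R) (hR1 : R < 1 / 2) (hR2 : R < 1 / ((32 * D + 40) * c + 4 * q + 8)) :
    0 ≤ 2 * R / (1 - R) * (4 * c * (2 * (D + 1) + R) + q + 2) ∧
      2 * R / (1 - R) * (4 * c * (2 * (D + 1) + R) + q + 2) < 1 := by
  have h1 : 0 < 1 - R := by linarith
  refine ⟨by positivity, ?_⟩
  rw [lt_div_iff₀ (by positivity)] at hR2
  have h2 : 2 * R / (1 - R) ≤ 4 * R := by
    rw [div_le_iff₀ h1]
    nlinarith
  have h3 : 4 * c * (2 * (D + 1) + R) ≤ 4 * c * (2 * (D + 1) + 1 / 2) := by gcongr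
  -- Expanded, the middle expression is `R ((32 D + 40) c + 4 q + 8)`, exactly the quantity bounded
  -- in `hR2`.
  calc _ ≤ 4 * R * (4 * c * (2 * (D + 1) + 1 / 2) + q + 2) := by gcongr
    _ < 1 := by linarith

theorem RIP_constant_nonneg [NeZero d] {n : Fin d → ℕ} {m : ℕ}
    {A : Tensor n →ₗ[ℝ] EuclideanSpace ℝ (Fin m)} {q : ℕ} {R : ℝ} (hA : FirstModeRIP A q R)
    {T : Tensor n} (hT : T ≠ 0) (hq : (unfold 0 T).rank ≤ q) : 0 ≤ R := by
  obtain ⟨h1, h2⟩ := hA T hq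
  have : 0 < ‖T‖ ^ 2 := by positivity
  nlinarith

end TensorRecovery

end

/-! ### The convergence theorem -/

theorem theorem2 {d : ℕ} [NeZero d] {n : Fin d → ℕ} {m : ℕ}
    (A : TensorRecovery.Tensor n →ₗ[ℝ] EuclideanSpace ℝ (Fin m))
    (T : TensorRecovery.Tensor n) (hT : T ≠ 0)
    (r : Fin d → ℕ) (hr : ∀ i, (TensorRecovery.unfold i T).rank = r i)
    (R : ℝ) (hRIP : TensorRecovery.FirstModeRIP A (3 * r 0) R)
    (κ₁ : ℝ) (hκ : κ₁ = TensorRecovery.condNumber (TensorRecovery.unfold 0 T) (r 0))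
    (hR : R < min (1 / 2)
      (1 / ((32 * √((d : ℝ) - 1) + 40) * √(r 0 : ℝ) * κ₁ + 4 * √(d : ℝ) + 8)))
    (γ₂ : ℝ)
    (hγ : γ₂ = 2 * R / (1 - R) *
      (4 * √(r 0 : ℝ) * κ₁ * (2 * (√((d : ℝ) - 1) + 1) + R) + √(d : ℝ) + 2))
    (α : ℕ → ℝ) (X Xhat W : ℕ → TensorRecovery.Tensor n)
    (U : ℕ → (i : Fin d) → Matrix (Fin (n i)) (Fin (r i)) ℝ)
    (s : ℕ → Fin (r 0) → ℝ) (V : ℕ → Matrix (TensorRecovery.ColIdx n 0) (Fin (r 0)) ℝ)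
    (hrun : TensorRecovery.IsSMQRGD A T r α X Xhat W U s V)
    (hα : ∀ k, α k =
      ‖TensorRecovery.modeTangentProj (U k 0) (V k) (TensorRecovery.normalOp A (T - X k))‖ ^ 2 /
      ‖A (TensorRecovery.modeTangentProj (U k 0) (V k)
        (TensorRecovery.normalOp A (T - X k)))‖ ^ 2) :
    (0 ≤ γ₂ ∧ γ₂ < 1) ∧
      ∀ k : ℕ, ‖X (k + 1) - T‖ ≤
        (√(d : ℝ) + 1) * (8 * √((d : ℝ) - 1) + 10) * γ₂ ^ k * ‖T‖ := by
  open TensorRecovery in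
  have hr' : ∀ i, (unfold i T).rank ≤ r i := fun i => (hr i).le
  obtain ⟨hσ, hr0, hκ0, hTσ⟩ := norm_le_sqrt_rank_mul_condNumber T hT
  rw [hr 0] at hσ hr0 hκ0 hTσ
  rw [← hκ] at hκ0 hTσ
  have hR0 : 0 ≤ R := RIP_constant_nonneg hRIP hT (by rw [hr 0]; omega)
  obtain ⟨hR1, hR2⟩ := lt_min_iff.mp hR
  set D := √((d : ℝ) - 1) with hD
  set q := √(d : ℝ) with hq
  have hD0 : 0 ≤ D := Real.sqrt_nonneg _
  have hq0 : 0 ≤ q := Real.sqrt_nonneg _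
  have hc0 : 0 ≤ √(r 0 : ℝ) * κ₁ := by positivity
  have hγ' : γ₂ = 2 * R / (1 - R) * (4 * (√(r 0 : ℝ) * κ₁) * (2 * (D + 1) + R) + q + 2) := by
    rw [hγ]
    ring
  have hγ01 : 0 ≤ γ₂ ∧ γ₂ < 1 := by
    rw [hγ']
    exact contraction_factor_lt_one hD0 hq0 hc0 hR0 hR1 (by rwa [mul_assoc] at hR2)
  refine ⟨hγ01, fun k => ?_⟩
  have hd : 1 ≤ d := Nat.one_le_iff_ne_zero.mpr (NeZero.ne d)
  have hU : ∀ k i, (U k i).transpose * U k i = 1 := fun k => (hrun.sthosvd k).orthonormal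
  have hV : ∀ k, (V k).transpose * V k = 1 := fun k => (hrun.svd k).right_orthonormal
  have hXhat : ∀ k, Xhat k = tuckerMul (partialProj (U k) 1) (W k) := fun k => by
    rw [hrun.xhat, refold_eq_partialProj_one (hrun.svd k)]
  have hWXhat : ∀ k, ‖W k - Xhat k‖ ≤ ‖W k - T‖ := fun k => by
    rw [hrun.xhat]
    exact (hrun.svd k).norm_sub_refold_le (hr' 0)
  have hxe : ∀ k, ‖X k - T‖ ≤ (q + 1) * ‖W k - T‖ := fun k => by
    have h1 := (hrun.sthosvd k).norm_sub_tuckerApprox_le hr' (Nat.zero_le d)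
    rw [tuckerMul_partialProj_zero, ← hrun.x, Nat.cast_zero, sub_zero, ← hq, norm_sub_rev] at h1
    have h2 := norm_sub_le_norm_sub_add_norm_sub (X k) (W k) T
    linarith
  have hxh : ∀ k, ‖X k - T‖ ≤ (D + 1) * ‖Xhat k - T‖ := fun k => by
    have h1 := (hrun.sthosvd k).norm_sub_tuckerApprox_le hr' hd
    rw [← hXhat, ← hrun.x, Nat.cast_one, ← hD, norm_sub_rev] at h1
    have h2 := norm_sub_le_norm_sub_add_norm_sub (X k) (Xhat k) T
    linarith
  have hrec := error_recursion (e := fun k => ‖W k - T‖) (h := fun k => ‖Xhat k - T‖)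
    (x := fun k => ‖X k - T‖)
    (ν := fun k => ‖T - modeTangentProj (U k 0) (V k) T‖) hD0 hq0 hR0 hR1 hc0 hσ
    (norm_nonneg T) (fun k => norm_nonneg _) (fun k => norm_nonneg _) rfl hγ' hγ01.2.le
    hTσ ?_ hxe hxh ?_ ?_ ?_ ?_ k
  · have h1 : 2 * R / (1 - R) ≤ 4 * R := by
      rw [div_le_iff₀ (by linarith)]
      nlinarith
    -- The prefactor `ρ` is in fact at most `4 D + 5`, since `R < 1/2`.
    have h2 : 2 * R / (1 - R) * (2 * (D + 1) + R) ≤ 8 * D + 10 := by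
      calc _ ≤ 4 * R * (2 * (D + 1) + R) := by gcongr
        _ ≤ 2 * (2 * (D + 1) + 1 / 2) := by
          gcongr
          linarith
        _ ≤ _ := by linarith
    have hγk : 0 ≤ γ₂ ^ k := pow_nonneg hγ01.1 k
    calc ‖X (k + 1) - T‖ ≤ (q + 1) * ‖W (k + 1) - T‖ := hxe _
      _ ≤ (q + 1) * ((8 * D + 10) * γ₂ ^ k * ‖T‖) := by
        refine mul_le_mul_of_nonneg_left (hrec.trans ?_) (by positivity)
        gcongr
      _ = _ := by ring
  · intro k
    have h1 := norm_sub_le_norm_sub_add_norm_sub (Xhat k) (W k) T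
    have h2 := hWXhat k
    rw [norm_sub_rev] at h2
    linarith
  · exact fun k => norm_sub_modeTangentProj_le (hU k 0) (hV k) T _ _ (hrun.xhat k)
  · intro k
    have h1 := singularValue_mul_norm_sub_modeTangentProj_le (hU k 0) (hV k) T _ _ (hrun.xhat k)
    rwa [hr 0] at h1
  -- Combinations of `T` and `Xhat 0` have first-mode rank at most `2 r₁`, and `Xhat 0` is at least
  -- as close to `A* A T` as `T` is.
  · refine norm_sub_le_of_norm_sub_normal_le A T (Xhat 0) (fun a b => hRIP _ ?_) hR0 ?_
    · rw [unfold_add, unfold_smul, unfold_smul, hrun.xhat 0, unfold_refold]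
      have h1 := rank_add_le (a • unfold 0 T)
        (b • (U 0 0 * Matrix.diagonal (s 0) * (V 0).transpose))
      have h2 := rank_smul_le a (unfold 0 T)
      have h3 := rank_smul_le b (U 0 0 * Matrix.diagonal (s 0) * (V 0).transpose)
      have h4 := rank_mul_le_width (U 0 0) (Matrix.diagonal (s 0) * (V 0).transpose)
      rw [← Matrix.mul_assoc] at h4
      have h5 := hr 0
      omega
    · have h1 := hWXhat 0
      rwa [hrun.init] at h1
  · intro k
    have h1 := norm_projected_step_le A (modeTangentProjLin (U k 0) (V k))
      modeTangentProjLin_isSymmetric (fun x => ?_) hR0 (by linarith) (X k) T ?_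
      (fun Z a => hRIP _ (rank_tangent_add_normal_le (hr' 0) Z a)) (hα k)
    · simp only [hrun.step]
      exact h1
    · apply unfold_injective 0
      simp only [modeTangentProjLin_apply, unfold_modeTangentProj]
      exact tangentProj_tangentProj (hU k 0) (hV k) _
    · rw [hrun.x]
      exact modeTangentProj_eq_self (hU k 0) _
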